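/- Notation. For $q\in(1,2]$ and $x>0$, a $q$-expansion of $x$ is a sequence $(d_i)_{i\ge1}\in\{0,1\}^{\mathbb N}$ with $x=(d_i)_q:=\sum_{i\ge 1}d_iq^{-i}$. Let $\mathscr U(x)$ be the set of all $q\in(1,2]$ for which $x$ has a unique $q$-expansion, $q_s(x):=\inf\mathscr U(x)$, $\mathscr U:=\mathscr U(1)$, and let $\overline{\mathscr U}$ be the closure of $\mathscr U$. Sequences are compared lexicographically ($\prec,\preccurlyeq$), $\sigma$ is the left shift, and a bar over a sequence or word of digits denotes its reflection ($0\leftrightarrow1$). For $q\in(1,2]$ let $\alpha(q)=\alpha_1(q)\alpha_2(q)\ldots$ be the quasi-greedy $q$-expansion of $1$, i.e. the lexicographically largest $q$-expansion of $1$ not ending with $0^\infty$, and put \[\mathscr V:=\{q\in(1,2]:\overline{\alpha(q)}\preccurlyeq\sigma^n(\alpha(q))\preccurlyeq\alpha(q)\ \ \forall n\ge0\}.\] Let $q_G=(1+\sqrt5)/2$. The algorithm. Let $x\in(0,1)$ and let $m\ge1$ be the integer with $q_G^{-m}\le x<q_G^{-m+1}$. Step 1: $q_1(x)$ is the unique root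 in $(1,2)$ of $q^m(q-1)=1/x$. Suppose that step $k\ge1$ has produced $q_k=q_k(x)$ and that $B_1,\dots,B_{k-1}$ are already defined. If $q_k\in\overline{\mathscr U}$, the algorithm stops. Otherwise let $n_k:=\min\{n\ge1:\overline{\alpha_n(q_k)\alpha_{n+1}(q_k)\ldots}\succcurlyeq\alpha(q_k)\}$ and $B_k:=1\,\overline{\alpha_1(q_k)\ldots\alpha_{n_k-2}(q_k)}$, and let $q_{k+1}(x)\in(1,2]$ be the base $q$ with $(0^{m-1}B_1\ldots B_k01^\infty)_{q}=x$. The number $q_k(x)$ is called the $k$-th lower bound for $q_s(x)$; it is defined for all $k$ up to the step, if any, at which the algorithm stops. Proposition. Let $x\in(0,1)$ with $x\ne q_G^{-m}$ for all $m\in\mathbb N$. Then $q_s$ has a jump at $x$ (that is, both one-sided limits of $q_s$ at $x$ exist and they are different) if and only if $q_k(x)\in\mathscr V\setminus\overline{\mathscr U}$ for some $k$. Moreover, if this is the case and $k_0$ is the smallest such $k$, then \[\lim_{y\nearrow x}q_s(y)=q_{k_0}(x)<q_s(x).\] -/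

import Mathlib

open Set Filter Topology

namespace UnivoqueBase

noncomputable section

/-- Infinite sequences of digits `0 = false`, `1 = true`. The entry at index `i : ℕ` is the
`(i + 1)`-st digit. They are compared lexicographically through `toLex`. -/
abbrev Digits : Type := ℕ → Bool

/-- The digit sequence `d` is a `q`-expansion of `x`: `x = d₁ / q + d₂ / q ^ 2 + ⋯`. -/
def IsExpansion (q x : ℝ) (d : Digits) : Prop :=
  HasSum (fun i : ℕ => (if d i then (1 : ℝ) else 0) / q ^ (i + 1)) x

/-- The set of bases `q ∈ (1, 2]` in which `x` has a unique expansion. -/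
def univoqueBases (x : ℝ) : Set ℝ :=
  {q | q ∈ Ioc (1 : ℝ) 2 ∧ ∃! d : Digits, IsExpansion q x d}

/-- The infimum `q_s(x)` of the bases in which `x` has a unique expansion. -/
def qs (x : ℝ) : ℝ := sInf (univoqueBases x)

/-- The set of bases in which `1` has a unique expansion. -/
def U : Set ℝ := univoqueBases 1

/-- `d` is the lexicographically largest `q`-expansion of `x` that does not end with `0^∞`. -/
def IsQuasiGreedy (q x : ℝ) (d : Digits) : Prop :=
  IsGreatest
    {e : Lex Digits | IsExpansion q x (ofLex e) ∧ ∀ n : ℕ, ∃ m : ℕ, n ≤ m ∧ ofLex e m = true}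
    (toLex d)

/-- The quasi-greedy expansion `α(q)` of `1` in base `q`, for `q ∈ (1, 2]`. -/
def alpha (q : ℝ) : Digits := Classical.epsilon (IsQuasiGreedy q 1)

/-- The reflection, which exchanges the digits `0` and `1`. -/
def reflect (d : Digits) : Digits := fun i => !d i

/-- The sequence with its first `n` digits removed. -/
def shift (n : ℕ) (d : Digits) : Digits := fun i => d (n + i)

/-- The set `V` of bases `q ∈ (1, 2]` such that every shift of `α(q)` lies lexicographically
between the reflection of `α(q)` and `α(q)`. -/
def V : Set ℝ :=
  {q | q ∈ Ioc (1 : ℝ) 2 ∧ ∀ n : ℕ,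
    toLex (reflect (alpha q)) ≤ toLex (shift n (alpha q)) ∧
      toLex (shift n (alpha q)) ≤ toLex (alpha q)}

/-- The word `w` followed by the infinite sequence `d`. -/
def prepend (w : List Bool) (d : Digits) : Digits :=
  fun i => if h : i < w.length then w[i] else d (i - w.length)

/-- The sequence `0 1^∞`. -/
def zeroOnes : Digits := fun i => decide (0 < i)

/-- For `x ∈ (0, 1)`, the unique `m ≥ 1` with `q_G ^ (-m) ≤ x < q_G ^ (-m + 1)`, where `q_G` is
the golden ratio. -/
def level (x : ℝ) : ℕ :=
  Classical.epsilon fun m : ℕ =>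
    1 ≤ m ∧ Real.goldenRatio ^ (-(m : ℤ)) ≤ x ∧ x < Real.goldenRatio ^ (-(m : ℤ) + 1)

/-- The unique root `q ∈ (1, 2)` of `q ^ m * (q - 1) = 1 / x`, where `m` is the level of `x`. -/
def qStar (x : ℝ) : ℝ :=
  Classical.epsilon fun q : ℝ => q ∈ Ioo (1 : ℝ) 2 ∧ q ^ level x * (q - 1) = 1 / x

/-- The base `q ∈ (1, 2]` in which `d` is an expansion of `x`. -/
def baseOf (x : ℝ) (d : Digits) : ℝ :=
  Classical.epsilon fun q : ℝ => q ∈ Ioc (1 : ℝ) 2 ∧ IsExpansion q x d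

/-- The smallest `n ≥ 1` such that the reflection of `α_n(q) α_{n+1}(q) …` is lexicographically at
least `α(q)`. (Such `n` exists if `q` is not in the closure of `U`.) -/
def blockIndex (q : ℝ) : ℕ :=
  sInf {n : ℕ | 1 ≤ n ∧ toLex (alpha q) ≤ toLex (reflect (shift (n - 1) (alpha q)))}

/-- The block consisting of the digit `1` and the reflections of `α_1(q), …, α_{n-2}(q)`, where
`n = blockIndex q`. -/
def block (q : ℝ) : List Bool :=
  true :: (List.range (blockIndex q - 2)).map fun i => reflect (alpha q) i

/-- The data of the algorithm. Entry `k : ℕ` belongs to step `k + 1` and consists of the word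
`0^(m-1) B_1 … B_k` (with `m` the level of `x`) and of the base `q_{k+1}(x)`. The base of step `1`
is `qStar x`; in every later step the base `q` is determined by
`(0^(m-1) B_1 … B_k 0 1^∞)_q = x`. -/
def algorithm (x : ℝ) : ℕ → List Bool × ℝ
  | 0 => (List.replicate (level x - 1) false, qStar x)
  | k + 1 =>
    let w := (algorithm x k).1 ++ block (algorithm x k).2
    (w, baseOf x (prepend w zeroOnes))

/-- The lower bound for `q_s(x)` found in step `k + 1` of the algorithm. -/
def lowerBound (x : ℝ) (k : ℕ) : ℝ := (algorithm x k).2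

/-- The algorithm stops as soon as a lower bound is in the closure of `U`. So step `k + 1` is
carried out if and only if no earlier lower bound is in the closure of `U`. -/
def Reached (x : ℝ) (k : ℕ) : Prop := ∀ j < k, lowerBound x j ∉ closure U

/-- The indices of those lower bounds, among the ones that the algorithm produces, that lie in
`V` but not in the closure of `U`. -/
def jumpSteps (x : ℝ) : Set ℕ :=
  {k | Reached x k ∧ lowerBound x k ∈ V \ closure U}

/-- `f` has a jump at `x`: the two one-sided limits exist and are different. -/
def HasJumpAt (f : ℝ → ℝ) (x : ℝ) : Prop :=
  ∃ l r : ℝ, Tendsto f (𝓝[<] x) (𝓝 l) ∧ Tendsto f (𝓝[>] x) (𝓝 r) ∧ l ≠ r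

end

end UnivoqueBase

/-! Write w_k for `word x k`, q_k for `lowerBound x k` (indexed from 0) and a_k for `alpha q_k`.

Lower bounds. If in base q the number y lies between the values of w_k10^∞ and w_k01^∞, then both
digits can follow w_k in an expansion of y, so y is not univoque in base q. The upper end of this
switch interval equals x exactly at q_k. The blocks are chosen so that the intervals of w_k and
w_{k+1} overlap in all bases up to q_k (`lowerVal_succ_le`). Chaining them excludes all bases below
q_k at x, and nearly all of them for y slightly above x (`not_mem_univoqueBases_of_le_upperVal`). If
q_k lies neither in V nor in the closure of U, the overlap at q_k is strict and persists for y
slightly below x (`lowerVal_succ_lt`).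

The jump. If q_k is in V but not in the closure of U, the two intervals only touch at q_k. For y < x
a gap opens: w_k1 followed by the reflection of a_k has the value x in base q_k and is univoque in
the bases above q_k (`lexUnivoque_reflect`). At the first such k the left limit is therefore q_k.

Upper bounds. Sequences w_k1c with suitable periodic c (`cyc`) are also univoque in the bases above
q_k (`lexUnivoque_cyc`), and they represent all y near x. If the algorithm stops, c can be taken
close to the reflection of a_k. Otherwise w_k1c = w_{k+1}1c, and the growing length of the words
forces the base below any R > sup q_k. So the supremum Q of the q_k is both q_s(x) and the right
limit (`exists_limit`, `tendsto_qs`). It exceeds q_k at a jump step because the q_k increase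
strictly; without jump steps Q is the two-sided limit. -/

namespace UnivoqueBase

noncomputable section

/-! ### Values of digit sequences -/

/-- The value of the digit sequence `d` in base `q`. -/
def val (q : ℝ) (d : Digits) : ℝ := ∑' i : ℕ, (if d i then (1 : ℝ) else 0) / q ^ (i + 1)

/-- The value of the first `n` digits of `d` in base `q`. -/
def pre (q : ℝ) (d : Digits) (n : ℕ) : ℝ :=
  ∑ i ∈ Finset.range n, (if d i then (1 : ℝ) else 0) / q ^ (i + 1)

/-- The first `n` digits of `d`, followed by `e`. -/
def glue (d : Digits) (n : ℕ) (e : Digits) : Digits := fun i => if i < n then d i else e (i - n)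

/-- The digit `b`, followed by `d`. -/
def cons (b : Bool) (d : Digits) : Digits
  | 0 => b
  | i + 1 => d i

/-- The sequence `1^∞`. -/
def ones : Digits := fun _ => true

/-- The sequence `0^∞`. -/
def zeros : Digits := fun _ => false

lemma term_nonneg {q : ℝ} (hq : 0 < q) (b : Bool) (i : ℕ) :
    0 ≤ (if b then (1 : ℝ) else 0) / q ^ (i + 1) := by
  split_ifs <;> positivity

lemma term_le {q : ℝ} (hq : 0 < q) (b : Bool) (i : ℕ) :
    (if b then (1 : ℝ) else 0) / q ^ (i + 1) ≤ 1 / q ^ (i + 1) := by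
  split_ifs
  · exact le_rfl
  · rw [zero_div]; positivity

lemma hasSum_one_div_pow {q : ℝ} (hq : 1 < q) :
    HasSum (fun i : ℕ => 1 / q ^ (i + 1)) (1 / (q - 1)) := by
  have h0 : (0 : ℝ) < q := by linarith
  have h := (hasSum_geometric_of_lt_one (inv_nonneg.2 h0.le) (inv_lt_one_of_one_lt₀ hq)).mul_left q⁻¹
  have h1 : q - 1 ≠ 0 := by linarith
  have h2 : 1 - q⁻¹ ≠ 0 := by
    have := inv_lt_one_of_one_lt₀ hq
    linarith
  have e1 : (fun i : ℕ => 1 / q ^ (i + 1)) = fun i => q⁻¹ * q⁻¹ ^ i := by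
    funext i
    rw [← pow_succ', inv_pow, one_div]
  have e2 : 1 / (q - 1) = q⁻¹ * (1 - q⁻¹)⁻¹ := by
    field_simp
  rw [e1, e2]
  exact h

lemma summable_term {q : ℝ} (hq : 1 < q) (d : Digits) :
    Summable fun i : ℕ => (if d i then (1 : ℝ) else 0) / q ^ (i + 1) :=
  Summable.of_nonneg_of_le (fun i => term_nonneg (by linarith) _ i)
    (fun i => term_le (by linarith) _ i) (hasSum_one_div_pow hq).summable

lemma isExpansion_iff {q : ℝ} (hq : 1 < q) {x : ℝ} {d : Digits} :
    IsExpansion q x d ↔ val q d = x :=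
  ⟨fun h => h.tsum_eq, fun h => h ▸ (summable_term hq d).hasSum⟩

lemma shift_shift (m n : ℕ) (d : Digits) : shift m (shift n d) = shift (n + m) d := by
  funext i; simp [shift, add_assoc]

@[simp] lemma shift_zero (d : Digits) : shift 0 d = d := by
  funext i; simp [shift]

@[simp] lemma reflect_reflect (d : Digits) : reflect (reflect d) = d := by
  funext i; simp [reflect]

lemma reflect_shift (n : ℕ) (d : Digits) : reflect (shift n d) = shift n (reflect d) := rfl

lemma shift_glue (d : Digits) (n : ℕ) (e : Digits) : shift n (glue d n e) = e := by
  funext i; simp [shift, glue]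

lemma val_eq_pre_add {q : ℝ} (hq : 1 < q) (d : Digits) (n : ℕ) :
    val q d = pre q d n + val q (shift n d) / q ^ n := by
  rw [val, ← (summable_term hq d).sum_add_tsum_nat_add n, pre, val, ← tsum_div_const]
  congr 1
  refine tsum_congr fun i => ?_
  rw [shift, add_comm n i, div_div, ← pow_add]
  congr 2
  ring

lemma pre_congr {q : ℝ} {d e : Digits} {n : ℕ} (h : ∀ i < n, d i = e i) :
    pre q d n = pre q e n :=
  Finset.sum_congr rfl fun i hi => by rw [h i (Finset.mem_range.1 hi)]

lemma val_glue {q : ℝ} (hq : 1 < q) (d : Digits) (n : ℕ) (e : Digits) :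
    val q (glue d n e) = pre q d n + val q e / q ^ n := by
  rw [val_eq_pre_add hq _ n, shift_glue, pre_congr (e := d)]
  intro i hi
  simp [glue, hi]

lemma pre_succ (q : ℝ) (d : Digits) (n : ℕ) :
    pre q d (n + 1) = pre q d n + (if d n then (1 : ℝ) else 0) / q ^ (n + 1) :=
  Finset.sum_range_succ _ _

lemma pre_zero (q : ℝ) (d : Digits) : pre q d 0 = 0 := Finset.sum_range_zero _

lemma val_cons {q : ℝ} (hq : 1 < q) (b : Bool) (d : Digits) :
    val q (cons b d) = ((if b then (1 : ℝ) else 0) + val q d) / q := by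
  have h : shift 1 (cons b d) = d := by
    funext i
    simp only [shift, add_comm 1 i, cons]
  rw [val_eq_pre_add hq _ 1, h, pre_succ, pre_zero]
  cases b <;> simp [cons, add_div]

lemma val_nonneg {q : ℝ} (hq : 1 < q) (d : Digits) : 0 ≤ val q d :=
  tsum_nonneg fun i => term_nonneg (by linarith) _ i

lemma val_ones {q : ℝ} (hq : 1 < q) : val q ones = 1 / (q - 1) := by
  rw [val, ← (hasSum_one_div_pow hq).tsum_eq]
  simp [ones]

lemma val_zeros (q : ℝ) : val q zeros = 0 := by
  simp [val, zeros]

lemma val_reflect {q : ℝ} (hq : 1 < q) (d : Digits) :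
    val q (reflect d) = 1 / (q - 1) - val q d := by
  rw [eq_sub_iff_add_eq, val, val, ← (summable_term hq _).tsum_add (summable_term hq _),
    ← (hasSum_one_div_pow hq).tsum_eq]
  refine tsum_congr fun i => ?_
  cases h : d i <;> simp [reflect, h]

lemma val_le {q : ℝ} (hq : 1 < q) (d : Digits) : val q d ≤ 1 / (q - 1) := by
  have := val_nonneg hq (reflect d)
  rw [val_reflect hq] at this
  linarith

lemma val_pos {q : ℝ} (hq : 1 < q) {d : Digits} {n : ℕ} (h : d n = true) : 0 < val q d := by
  refine (summable_term hq d).tsum_pos (fun i => term_nonneg (by linarith) _ i) n ?_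
  have : (0 : ℝ) < q := by linarith
  simp only [h, if_true]
  positivity

lemma term_anti {q r : ℝ} (hq : 0 < q) (hqr : q ≤ r) (b : Bool) (i : ℕ) :
    (if b then (1 : ℝ) else 0) / r ^ (i + 1) ≤ (if b then (1 : ℝ) else 0) / q ^ (i + 1) := by
  have : (0 : ℝ) ≤ if b then (1 : ℝ) else 0 := by split_ifs <;> norm_num
  gcongr

lemma val_anti {q r : ℝ} (hq : 1 < q) (hqr : q ≤ r) (d : Digits) : val r d ≤ val q d :=
  (summable_term (hq.trans_le hqr) d).tsum_le_tsum
    (fun i => term_anti (by linarith) hqr _ i) (summable_term hq d)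

lemma val_strictAnti {q r : ℝ} (hq : 1 < q) (hqr : q < r) {d : Digits} {n : ℕ}
    (h : d n = true) : val r d < val q d := by
  have h0 : 0 < q := by linarith
  refine Summable.tsum_lt_tsum (i := n) (fun i => term_anti h0 hqr.le _ i) ?_
    (summable_term (hq.trans hqr) d) (summable_term hq d)
  simp only [h, if_true]
  gcongr

lemma lt_of_val_lt {q r : ℝ} {d : Digits} (h : val r d < val q d) (hr : 1 < r) :
    q < r := by
  by_contra hle
  exact absurd (val_anti hr (not_lt.1 hle) d) (not_le.2 h)

lemma continuousOn_val (d : Digits) {r : ℝ} (hr : 1 < r) :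
    ContinuousOn (fun q => val q d) (Ici r) := by
  have h0 : 0 < r := by linarith
  refine continuousOn_tsum (u := fun i : ℕ => 1 / r ^ (i + 1)) (fun i => ?_)
    (hasSum_one_div_pow hr).summable fun i q hq => ?_
  · refine continuousOn_const.div (continuousOn_id.pow _) fun q hq => ?_
    have : 0 < q := h0.trans_le hq
    exact pow_ne_zero _ this.ne'
  · have hq' : r ≤ q := hq
    have h1 : 0 < q := h0.trans_le hq'
    rw [Real.norm_of_nonneg (term_nonneg h1 _ _)]
    refine (term_le h1 _ _).trans ?_
    gcongr

lemma exists_base {q r y : ℝ} {d : Digits} (hq : 1 < q) (hqr : q ≤ r) (h1 : y < val q d)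
    (h2 : val r d < y) : ∃ p ∈ Ioo q r, val p d = y := by
  have := intermediate_value_Ioo' hqr ((continuousOn_val d hq).mono Icc_subset_Ici_self)
  exact this ⟨h2, h1⟩

lemma pre_anti {q r : ℝ} (hq : 0 < q) (hqr : q ≤ r) (d : Digits) (n : ℕ) :
    pre r d n ≤ pre q d n :=
  Finset.sum_le_sum fun i _ => term_anti hq hqr _ i

lemma pre_le_val {q : ℝ} (hq : 1 < q) (d : Digits) (n : ℕ) : pre q d n ≤ val q d := by
  rw [val_eq_pre_add hq d n]
  have := val_nonneg hq (shift n d)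
  have h0 : 0 < q := by linarith
  have : 0 ≤ val q (shift n d) / q ^ n := by positivity
  linarith

lemma val_le_pre_add {q : ℝ} (hq : 1 < q) (d : Digits) (n : ℕ) :
    val q d ≤ pre q d n + 1 / (q - 1) / q ^ n := by
  rw [val_eq_pre_add hq d n]
  have := val_le hq (shift n d)
  have h0 : 0 < q := by linarith
  gcongr

lemma val_sub_le {q : ℝ} (hq : 1 < q) {d e : Digits} {n : ℕ} (h : ∀ i < n, d i = e i) :
    val q d ≤ val q e + 1 / (q - 1) / q ^ n := by
  have h1 := val_le_pre_add hq d n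
  have h2 := pre_le_val hq e n
  rw [pre_congr h] at h1
  linarith

/-- If `a` has the value `x` in base `q`, then sequences with a long common prefix with `a` represent
the numbers near `x` in bases near `q`. -/
lemma exists_base_near {q x δ : ℝ} {a : Digits} {n : ℕ} (hn : a n = true) (hq : 1 < q)
    (ha : val q a = x) (hδ : 0 < δ) :
    ∃ N : ℕ, ∃ ε > 0, ∀ d : Digits, (∀ i < N, d i = a i) → ∀ y, |y - x| < ε →
      ∃ p, 1 < p ∧ |p - q| < δ ∧ val p d = y := by
  obtain ⟨r, hr1, hr2, hr3⟩ : ∃ r, 1 < r ∧ r < q ∧ q - δ < r :=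
    ⟨max ((1 + q) / 2) (q - δ / 2), lt_max_of_lt_left (by linarith),
      max_lt (by linarith) (by linarith), lt_max_of_lt_right (by linarith)⟩
  set s := q + δ / 2 with hs
  have hqs : q < s := by linarith
  have hs1 : 1 < s := by linarith
  have h1 : x < val r a := ha ▸ val_strictAnti hr1 hr2 hn
  have h2 : val s a < x := ha ▸ val_strictAnti hq hqs hn
  have key : ∀ {t : ℝ}, 1 < t → Tendsto (fun n : ℕ => 1 / (t - 1) / t ^ n) atTop (𝓝 0) := by
    intro t ht
    exact tendsto_const_nhds.div_atTop (tendsto_pow_atTop_atTop_of_one_lt ht)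
  -- One half of each gap absorbs the change of the digits after place N, the other half the
  -- distance from y to x.
  set ε := min ((val r a - x) / 2) ((x - val s a) / 2) with hε
  have hε0 : 0 < ε := lt_min (by linarith) (by linarith)
  obtain ⟨N, hN1, hN2⟩ := (((key hr1).eventually_lt_const hε0).and
    ((key hs1).eventually_lt_const hε0)).exists
  refine ⟨N, ε, hε0, fun d hd y hy => ?_⟩
  have e1 : ε ≤ (val r a - x) / 2 := min_le_left _ _
  have e2 : ε ≤ (x - val s a) / 2 := min_le_right _ _
  have hy' := abs_lt.1 hy
  have h3 := val_sub_le hr1 (fun i hi => (hd i hi).symm)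
  have h4 := val_sub_le hs1 hd
  obtain ⟨p, hp, hpd⟩ := exists_base (y := y) (d := d) hr1 (hr2.le.trans hqs.le) (by linarith)
    (by linarith)
  exact ⟨p, hr1.trans hp.1, abs_lt.2 ⟨by linarith [hp.1], by linarith [hp.2]⟩, hpd⟩

/-! ### Lexicographic order and first differences -/

/-- The sequence `a` is lexicographically smaller than `b`, and `n` is the first index at which they
differ. -/
def FirstLt (a b : Digits) (n : ℕ) : Prop :=
  (∀ i < n, a i = b i) ∧ a n = false ∧ b n = true

lemma toLex_lt_iff {a b : Digits} : toLex a < toLex b ↔ ∃ n, FirstLt a b n := by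
  constructor
  · rintro ⟨n, h1, h2⟩
    have h2' : a n < b n := h2
    exact ⟨n, h1, by simpa [Bool.lt_iff] using h2'⟩
  · rintro ⟨n, h1, h2⟩
    refine ⟨n, h1, ?_⟩
    change a n < b n
    simpa [Bool.lt_iff] using h2

lemma FirstLt.lt {a b : Digits} {n : ℕ} (h : FirstLt a b n) : toLex a < toLex b :=
  toLex_lt_iff.2 ⟨n, h⟩

lemma FirstLt.reflect {a b : Digits} {n : ℕ} (h : FirstLt a b n) :
    FirstLt (reflect b) (reflect a) n :=
  ⟨fun i hi => by simp [UnivoqueBase.reflect, h.1 i hi], by simp [UnivoqueBase.reflect, h.2.2],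
    by simp [UnivoqueBase.reflect, h.2.1]⟩

lemma reflect_lt_reflect {a b : Digits} (h : toLex a < toLex b) :
    toLex (reflect b) < toLex (reflect a) := by
  obtain ⟨n, hn⟩ := toLex_lt_iff.1 h
  exact hn.reflect.lt

lemma reflect_le_reflect {a b : Digits} (h : toLex a ≤ toLex b) :
    toLex (reflect b) ≤ toLex (reflect a) := by
  by_contra hlt
  have := reflect_lt_reflect (not_le.1 hlt)
  simp only [reflect_reflect] at this
  exact absurd h (not_le.2 this)

lemma shift_lt_shift {a b : Digits} {n : ℕ} (h : toLex a < toLex b) (hn : ∀ i < n, a i = b i) :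
    toLex (shift n a) < toLex (shift n b) := by
  obtain ⟨k, h1, h2, h3⟩ := toLex_lt_iff.1 h
  have hnk : n ≤ k := by
    by_contra hlt
    have := hn k (not_le.1 hlt)
    simp [h2, h3] at this
  refine FirstLt.lt (n := k - n) ⟨fun i hi => h1 _ (by omega), ?_, ?_⟩ <;>
    simpa [shift, Nat.add_sub_cancel' hnk]

lemma toLex_le_zero {a b : Digits} (h : toLex a ≤ toLex b) (ha : a 0 = true) : b 0 = true := by
  by_contra hb
  exact absurd h (not_le.2 (FirstLt.lt (n := 0) ⟨by simp, by simpa using hb, ha⟩))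

lemma FirstLt.val_sub {q : ℝ} (hq : 1 < q) {a b : Digits} {n : ℕ} (h : FirstLt a b n) :
    val q b - val q a = (1 + val q (shift (n + 1) b) - val q (shift (n + 1) a)) / q ^ (n + 1) := by
  rw [val_eq_pre_add hq a (n + 1), val_eq_pre_add hq b (n + 1), pre_succ, pre_succ,
    pre_congr h.1]
  simp only [h.2.1, h.2.2, if_true, Bool.false_eq_true, if_false]
  ring

/-- The sequence `a` has infinitely many digits `1`. -/
def InfOnes (a : Digits) : Prop := ∀ n : ℕ, ∃ m : ℕ, n ≤ m ∧ a m = true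

lemma InfOnes.exists_shift {a : Digits} (h : InfOnes a) (n : ℕ) : ∃ m, shift n a m = true := by
  obtain ⟨m, hm, ha⟩ := h n
  exact ⟨m - n, by simpa [shift, Nat.add_sub_cancel' hm]⟩

lemma InfOnes.shift_val_pos {a : Digits} (h : InfOnes a) {q : ℝ} (hq : 1 < q) (n : ℕ) :
    0 < val q (shift n a) := by
  obtain ⟨m, hm⟩ := h.exists_shift n
  exact val_pos hq hm

/-! ### Quasi-greedy expansions of 1 -/

/-- The remainders of the quasi-greedy algorithm in base `q` with start `r`. -/
def remainder (q r : ℝ) : ℕ → ℝ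
  | 0 => r
  | n + 1 => if 1 < q * remainder q r n then q * remainder q r n - 1 else q * remainder q r n

/-- The digits of the quasi-greedy algorithm in base `q` with start `r`. -/
def quasiGreedy (q r : ℝ) : Digits := fun n => decide (1 < q * remainder q r n)

lemma pre_add_remainder {q : ℝ} (hq : 1 < q) (r : ℝ) (n : ℕ) :
    pre q (quasiGreedy q r) n + remainder q r n / q ^ n = r := by
  have h0 : q ≠ 0 := by linarith
  induction n with
  | zero => simp [pre_zero, remainder]
  | succ n ih =>
    rw [pre_succ, remainder]
    refine Eq.trans ?_ ih
    by_cases h : 1 < q * remainder q r n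
    · simp only [quasiGreedy, h, decide_true, if_true]
      field_simp
      ring
    · simp only [quasiGreedy, h, decide_false, if_false, Bool.false_eq_true]
      field_simp
      ring

lemma remainder_mem {q r : ℝ} (hq : 1 < q) (hq2 : q ≤ 2) (hr : r ∈ Icc 0 (1 / (q - 1))) (n : ℕ) :
    remainder q r n ∈ Icc 0 (1 / (q - 1)) := by
  have h1 : 0 < q - 1 := by linarith
  induction n with
  | zero => exact hr
  | succ n ih =>
    have hid : q * (1 / (q - 1)) - 1 = 1 / (q - 1) := by field_simp; ring
    have h2 : (1 : ℝ) ≤ 1 / (q - 1) := by rw [le_div_iff₀ h1]; linarith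
    have h3 : q * remainder q r n ≤ q * (1 / (q - 1)) :=
      mul_le_mul_of_nonneg_left ih.2 (by linarith)
    rw [remainder]
    split_ifs with h
    · exact ⟨by linarith, by linarith⟩
    · exact ⟨mul_nonneg (by linarith) ih.1, by linarith⟩

lemma val_quasiGreedy {q r : ℝ} (hq : 1 < q) (hq2 : q ≤ 2) (hr : r ∈ Icc 0 (1 / (q - 1))) :
    val q (quasiGreedy q r) = r := by
  have h1 := (summable_term hq (quasiGreedy q r)).hasSum.tendsto_sum_nat
  refine tendsto_nhds_unique h1 ?_
  have h2 : Tendsto (fun n => remainder q r n / q ^ n) atTop (𝓝 0) := by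
    have h0 : Tendsto (fun n : ℕ => 1 / (q - 1) / q ^ n) atTop (𝓝 0) :=
      tendsto_const_nhds.div_atTop (tendsto_pow_atTop_atTop_of_one_lt hq)
    refine squeeze_zero (fun n => ?_) (fun n => ?_) h0
    · exact div_nonneg (remainder_mem hq hq2 hr n).1 (by positivity)
    · have := (remainder_mem hq hq2 hr n).2
      gcongr
  have h3 := h2.const_sub r
  rw [sub_zero] at h3
  refine h3.congr fun n => ?_
  have := pre_add_remainder hq r n
  rw [pre] at this
  linarith

lemma exists_val_eq {q r : ℝ} (hq : 1 < q) (hq2 : q ≤ 2) (h0 : 0 ≤ r) (h1 : r ≤ 1 / (q - 1)) :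
    ∃ d, val q d = r :=
  ⟨_, val_quasiGreedy hq hq2 ⟨h0, h1⟩⟩

/-- A characterization of the quasi-greedy expansion of `1` by the values of its shifts. -/
structure IsQG (q : ℝ) (a : Digits) : Prop where
  val_eq : val q a = 1
  inf : InfOnes a
  shift_val_le : ∀ n, val q (shift n a) ≤ 1

lemma isQG_quasiGreedy {q : ℝ} (hq : 1 < q) (hq2 : q ≤ 2) : IsQG q (quasiGreedy q 1) := by
  have h1 : 0 < q - 1 := by linarith
  have hr : (1 : ℝ) ∈ Icc 0 (1 / (q - 1)) :=
    ⟨zero_le_one, by rw [le_div_iff₀ h1]; linarith⟩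
  have hv := val_quasiGreedy hq hq2 hr
  have hrem : ∀ n, 0 < remainder q 1 n ∧ remainder q 1 n ≤ 1 := by
    intro n
    induction n with
    | zero => simp [remainder]
    | succ n ih =>
      rw [remainder]
      split_ifs with h
      · have : q * remainder q 1 n ≤ 2 * 1 :=
          mul_le_mul hq2 ih.2 ih.1.le (by norm_num)
        exact ⟨by linarith, by linarith⟩
      · exact ⟨mul_pos (by linarith) ih.1, by linarith⟩
  have hsh : ∀ n, val q (shift n (quasiGreedy q 1)) = remainder q 1 n := by
    intro n
    have e1 := pre_add_remainder hq 1 n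
    have e2 := val_eq_pre_add hq (quasiGreedy q 1) n
    rw [hv] at e2
    have hp : (0 : ℝ) < q ^ n := by positivity
    have e3 : val q (shift n (quasiGreedy q 1)) / q ^ n = remainder q 1 n / q ^ n := by linarith
    exact (div_left_inj' hp.ne').1 e3
  refine ⟨hv, fun n => ?_, fun n => (hsh n).trans_le (hrem n).2⟩
  by_contra hno
  push Not at hno
  have hz : shift n (quasiGreedy q 1) = zeros := by
    funext i
    simpa [shift, zeros] using hno (n + i) (by omega)
  have := hsh n
  rw [hz, val_zeros] at this
  exact absurd (hrem n).1 (by rw [← this]; exact lt_irrefl _)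

/-- At the first difference c has the extra digit 1, and the tail of a after that place is worth at
most 1. -/
lemma IsQG.one_le_val {q : ℝ} (hq : 1 < q) {a c : Digits} (ha : IsQG q a)
    (h : toLex a ≤ toLex c) : 1 ≤ val q c := by
  rcases h.eq_or_lt with h | h
  · have : a = c := toLex.injective h
    rw [← this, ha.val_eq]
  · obtain ⟨n, hn⟩ := toLex_lt_iff.1 h
    have h1 := hn.val_sub hq
    have h2 := ha.shift_val_le (n + 1)
    have h3 := val_nonneg hq (shift (n + 1) c)
    have h4 : 0 ≤ (1 + val q (shift (n + 1) c) - val q (shift (n + 1) a)) / q ^ (n + 1) :=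
      div_nonneg (by linarith) (by positivity)
    rw [ha.val_eq] at h1
    linarith

lemma IsQG.one_lt_val {q : ℝ} (hq : 1 < q) {a c : Digits} (ha : IsQG q a)
    (h : toLex a < toLex c) (hc : InfOnes c) : 1 < val q c := by
  obtain ⟨n, hn⟩ := toLex_lt_iff.1 h
  have h1 := hn.val_sub hq
  have h2 := ha.shift_val_le (n + 1)
  have h3 := hc.shift_val_pos hq (n + 1)
  have h4 : 0 < (1 + val q (shift (n + 1) c) - val q (shift (n + 1) a)) / q ^ (n + 1) :=
    div_pos (by linarith) (by positivity)
  rw [ha.val_eq] at h1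
  linarith

lemma InfOnes.shift {a : Digits} (ha : InfOnes a) (n : ℕ) : InfOnes (shift n a) := by
  intro m
  obtain ⟨k, hk, h⟩ := ha (n + m)
  exact ⟨k - n, by omega, by simpa [UnivoqueBase.shift, Nat.add_sub_cancel' (by omega : n ≤ k)]⟩

lemma IsQG.shift_le {q : ℝ} (hq : 1 < q) {a : Digits} (ha : IsQG q a) (n : ℕ) :
    toLex (shift n a) ≤ toLex a := by
  by_contra h
  exact absurd (ha.one_lt_val hq (not_le.1 h) (ha.inf.shift n)) (not_lt.2 (ha.shift_val_le n))

lemma isQuasiGreedy_iff {q : ℝ} (hq : 1 < q) (hq2 : q ≤ 2) {a : Digits} :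
    IsQuasiGreedy q 1 a ↔ IsQG q a := by
  have key : ∀ {b}, IsQG q b → IsQuasiGreedy q 1 b := by
    intro b hb
    refine ⟨⟨(isExpansion_iff hq).2 hb.val_eq, hb.inf⟩, fun e he => ?_⟩
    by_contra hlt
    have := hb.one_lt_val hq (c := ofLex e) (not_le.1 hlt) he.2
    rw [(isExpansion_iff hq).1 he.1] at this
    exact lt_irrefl _ this
  refine ⟨fun h => ?_, key⟩
  have h1 := key (isQG_quasiGreedy hq hq2)
  have : a = quasiGreedy q 1 := toLex.injective (IsGreatest.unique h h1)
  rw [this]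
  exact isQG_quasiGreedy hq hq2

lemma isQG_alpha {q : ℝ} (hq : 1 < q) (hq2 : q ≤ 2) : IsQG q (alpha q) :=
  (isQuasiGreedy_iff hq hq2).1 (Classical.epsilon_spec
    ⟨_, (isQuasiGreedy_iff hq hq2).2 (isQG_quasiGreedy hq hq2)⟩)

lemma alpha_lt_alpha {q r : ℝ} (hq : 1 < q) (hqr : q < r) (hr : r ≤ 2) :
    toLex (alpha q) < toLex (alpha r) := by
  have h1 := isQG_alpha hq (hqr.le.trans hr)
  have h2 := isQG_alpha (hq.trans hqr) hr
  by_contra hle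
  have h3 := h2.one_le_val (hq.trans hqr) (not_lt.1 hle)
  obtain ⟨m, hm⟩ := h1.inf.exists_shift 0
  rw [shift_zero] at hm
  have h4 := val_strictAnti hq hqr hm
  rw [h1.val_eq] at h4
  linarith

lemma IsQG.zero {q : ℝ} (hq : 1 < q) {a : Digits} (ha : IsQG q a) : a 0 = true := by
  by_contra h
  have h1 := val_eq_pre_add hq a 1
  rw [pre_succ, pre_zero, ha.val_eq] at h1
  have h2 := ha.shift_val_le 1
  have h3 : val q (UnivoqueBase.shift 1 a) / q < 1 := by
    rw [div_lt_one (by linarith)]; linarith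
  simp [h] at h1
  linarith

/-- Otherwise 1 ≤ 1/q + 1/q², which fails above the golden ratio. -/
lemma IsQG.one {q : ℝ} (hq : Real.goldenRatio < q) {a : Digits} (ha : IsQG q a) : a 1 = true := by
  have hg := Real.one_lt_goldenRatio
  have hq1 : 1 < q := hg.trans hq
  by_contra h
  have h1 := val_eq_pre_add hq1 a 2
  rw [pre_succ, pre_succ, pre_zero, ha.val_eq] at h1
  have h2 := ha.shift_val_le 2
  simp [h, ha.zero hq1] at h1
  have h0 : q ≠ 0 := by linarith
  field_simp at h1
  have := Real.goldenRatio_sq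
  nlinarith

/-! ### The lexicographic criterion for unique expansions -/

/-- The sequence `d` satisfies the lexicographic conditions for a unique expansion in a base with
quasi-greedy expansion `c` of `1`. -/
def LexUnivoque (c d : Digits) : Prop :=
  ∀ i, (d i = false → toLex (shift (i + 1) d) < toLex c) ∧
    (d i = true → toLex (reflect c) < toLex (shift (i + 1) d))

/-- The first difference between c and a tail of d after a 0 is again a 0 of d. The excess over 1 of
the first tail is less than that of the next one divided by a positive power of p. Tails have
bounded values, so iteration leaves no positive excess; one more step gives strictness, because c
has further digits 1. -/
lemma val_shift_lt_one {p : ℝ} (hp : 1 < p) {c d : Digits} (hc : val p c ≤ 1) (hc1 : InfOnes c)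
    (h : ∀ i, d i = false → toLex (shift (i + 1) d) < toLex c) {i : ℕ} (hi : d i = false) :
    val p (shift (i + 1) d) < 1 := by
  have hp0 : 0 < p := by linarith
  have step : ∀ i, d i = false → ∃ j k, d j = false ∧ val p (shift (i + 1) d) < 1 +
      (val p (shift (j + 1) d) - 1) / p ^ (k + 1) := by
    intro i hi
    obtain ⟨n, hn⟩ := toLex_lt_iff.1 (h i hi)
    refine ⟨i + 1 + n, n, hn.2.1, ?_⟩
    have h1 := hn.val_sub hp
    have h2 := hc1.shift_val_pos hp (n + 1)
    rw [shift_shift, ← add_assoc] at h1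
    have h3 : 0 < val p (shift (n + 1) c) / p ^ (n + 1) := by positivity
    have h4 : (1 + val p (shift (n + 1) c) - val p (shift (i + 1 + n + 1) d)) / p ^ (n + 1) =
      val p (shift (n + 1) c) / p ^ (n + 1)
        - (val p (shift (i + 1 + n + 1) d) - 1) / p ^ (n + 1) := by ring
    linarith
  have bound : ∀ n : ℕ, ∀ i, d i = false → val p (shift (i + 1) d) ≤ 1 + 1 / (p - 1) / p ^ n := by
    intro n
    have hp1 : 0 < p - 1 := by linarith
    induction n with
    | zero =>
      intro i _
      have := val_le hp (shift (i + 1) d)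
      simp only [pow_zero, div_one]
      linarith
    | succ n ih =>
      intro i hi
      obtain ⟨j, k, hj, hlt⟩ := step i hi
      have h1 : val p (shift (j + 1) d) - 1 ≤ 1 / (p - 1) / p ^ n := by linarith [ih j hj]
      have h2 : (val p (shift (j + 1) d) - 1) / p ^ (k + 1) ≤ 1 / (p - 1) / p ^ n / p := by
        calc _ ≤ 1 / (p - 1) / p ^ n / p ^ (k + 1) := by gcongr
          _ ≤ 1 / (p - 1) / p ^ n / p := by
            gcongr
            exact le_self_pow₀ hp.le (by omega)
      rw [pow_succ, ← div_div]
      linarith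
  have le : ∀ i, d i = false → val p (shift (i + 1) d) ≤ 1 := by
    intro i hi
    have h0 : Tendsto (fun n : ℕ => 1 + 1 / (p - 1) / p ^ n) atTop (𝓝 (1 + 0)) :=
      tendsto_const_nhds.add
        (tendsto_const_nhds.div_atTop (tendsto_pow_atTop_atTop_of_one_lt hp))
    rw [add_zero] at h0
    exact ge_of_tendsto' h0 fun n => bound n i hi
  obtain ⟨j, k, hj, hlt⟩ := step i hi
  have h1 := le j hj
  have h2 : (val p (shift (j + 1) d) - 1) / p ^ (k + 1) ≤ 0 :=
    div_nonpos_of_nonpos_of_nonneg (by linarith) (by positivity)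
  linarith

lemma firstLt_or {d e : Digits} (h : e ≠ d) : ∃ n, FirstLt d e n ∨ FirstLt e d n := by
  rcases lt_trichotomy (toLex e) (toLex d) with h1 | h1 | h1
  · obtain ⟨n, hn⟩ := toLex_lt_iff.1 h1
    exact ⟨n, Or.inr hn⟩
  · exact absurd (toLex.injective h1) h
  · obtain ⟨n, hn⟩ := toLex_lt_iff.1 h1
    exact ⟨n, Or.inl hn⟩

/-- A larger sequence of the same value would need a tail of d after a 0 worth at least 1.
Reflection turns a smaller sequence into a larger one. -/
lemma LexUnivoque.unique {p : ℝ} (hp : 1 < p) {c d : Digits} (hc : val p c ≤ 1) (hc1 : InfOnes c)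
    (h : LexUnivoque c d) {e : Digits} (he : val p e = val p d) : e = d := by
  by_contra hne
  have hp0 : 0 < p := by linarith
  have aux : ∀ {d e : Digits}, (∀ i, d i = false → toLex (shift (i + 1) d) < toLex c) →
      val p e = val p d → ∀ {n}, FirstLt d e n → False := by
    intro d e hd hv n hn
    have h1 := val_shift_lt_one hp hc hc1 hd hn.2.1
    have h2 := hn.val_sub hp
    have h3 := val_nonneg hp (shift (n + 1) e)
    have h4 : 0 < (1 + val p (shift (n + 1) e) - val p (shift (n + 1) d)) / p ^ (n + 1) :=
      div_pos (by linarith) (by positivity)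
    linarith
  obtain ⟨n, hn | hn⟩ := firstLt_or hne
  · exact aux (fun i => (h i).1) he hn
  · refine aux (d := reflect d) (e := reflect e) (fun i hi => ?_) ?_ hn.reflect
    · have h1 := reflect_lt_reflect ((h i).2 (by simpa [reflect] using hi))
      rwa [reflect_reflect, reflect_shift] at h1
    · rw [val_reflect hp, val_reflect hp, he]

/-- The sequence c need not be `alpha p`. In `mem_closure_U` it is the candidate expansion of 1
itself. -/
lemma LexUnivoque.mem {p y : ℝ} (hp : 1 < p) (hp2 : p ≤ 2) {c d : Digits} (hc : val p c ≤ 1)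
    (hc1 : InfOnes c) (h : LexUnivoque c d) (hy : val p d = y) : p ∈ univoqueBases y :=
  ⟨⟨hp, hp2⟩, d, (isExpansion_iff hp).2 hy, fun _ he =>
    h.unique hp hc hc1 (((isExpansion_iff hp).1 he).trans hy.symm)⟩

/-! ### Bases excluded by a switch interval -/

lemma not_mem_univoqueBases {q y : ℝ} (d : Digits) (n : ℕ)
    (h1 : pre q d n + 1 / q ^ (n + 1) ≤ y)
    (h2 : y ≤ pre q d n + 1 / (q - 1) / q ^ (n + 1)) : q ∉ univoqueBases y := by
  rintro ⟨⟨hq, hq2⟩, hu⟩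
  have hq0 : 0 < q := by linarith
  have hq1 : 0 < q - 1 := by linarith
  have hp : 0 < q ^ (n + 1) := by positivity
  -- Digit 1 leaves s - 1 to be represented and digit 0 leaves s; both lie between 0 and 1 / (q -
  -- 1).
  set s := (y - pre q d n) * q ^ (n + 1) with hs
  have hs1 : 1 ≤ s := by
    rw [hs, ← div_le_iff₀ hp]; linarith
  have hs2 : s ≤ 1 / (q - 1) := by
    rw [hs, ← le_div_iff₀ hp]; linarith
  obtain ⟨e, he⟩ := exists_val_eq hq hq2 (r := s - 1) (by linarith) (by linarith)
  obtain ⟨f, hf⟩ := exists_val_eq hq hq2 (r := s) (by linarith) hs2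
  have hy : pre q d n + s / q ^ (n + 1) = y := by
    rw [hs]; field_simp; ring
  have E1 : IsExpansion q y (glue d n (cons true e)) := by
    rw [isExpansion_iff hq, val_glue hq, val_cons hq, he, div_div, ← pow_succ', ← hy]
    simp
  have E2 : IsExpansion q y (glue d n (cons false f)) := by
    rw [isExpansion_iff hq, val_glue hq, val_cons hq, hf, div_div, ← pow_succ', ← hy]
    simp
  have := congrFun (hu.unique E1 E2) n
  simp [glue, cons] at this

/-- Here q ≤ 1 / (q - 1), so the switch intervals after the words 0^n cover (0, 1). -/
lemma not_mem_univoqueBases_of_le_goldenRatio {q y : ℝ} (hq : q ≤ Real.goldenRatio) (hy0 : 0 < y)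
    (hy1 : y < 1) : q ∉ univoqueBases y := by
  intro hmem
  have hq1 : 1 < q := hmem.1.1
  have hq0 : 0 < q := by linarith
  obtain ⟨n, h1, h2⟩ := exists_nat_pow_near_of_lt_one hy0 hy1.le (inv_pos.2 hq0)
    (inv_lt_one_of_one_lt₀ hq1)
  have hpre : pre q zeros n = 0 := by simp [pre, zeros]
  rw [inv_pow] at h1 h2
  refine not_mem_univoqueBases zeros n ?_ ?_ hmem <;> rw [hpre, zero_add]
  · rw [one_div]; exact h1.le
  · refine h2.trans ?_
    have h3 : q ≤ 1 / (q - 1) := by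
      rw [le_div_iff₀ (by linarith)]
      have := Real.goldenRatio_sq
      have := Real.one_lt_goldenRatio
      nlinarith
    calc (q ^ n)⁻¹ = q / q ^ (n + 1) := by rw [pow_succ]; field_simp
      _ ≤ 1 / (q - 1) / q ^ (n + 1) := by gcongr

/-! ### Prefix comparisons, special prefixes and the sequences built from them -/

/-- The word formed by the first `n` digits of `a` is smaller than the corresponding word of `b`. -/
def LtUpTo (n : ℕ) (a b : Digits) : Prop := ∃ k < n, FirstLt a b k

/-- The word formed by the first `n` digits of `a` is at most the corresponding word of `b`. -/
def LeUpTo (n : ℕ) (a b : Digits) : Prop := ∀ k < n, ¬FirstLt b a k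

lemma FirstLt.congr {a b c d : Digits} {n : ℕ} (h : FirstLt a b n) (hac : ∀ i ≤ n, a i = c i)
    (hbd : ∀ i ≤ n, b i = d i) : FirstLt c d n :=
  ⟨fun i hi => by rw [← hac i hi.le, ← hbd i hi.le, h.1 i hi], (hac n le_rfl).symm.trans h.2.1,
    (hbd n le_rfl).symm.trans h.2.2⟩

lemma FirstLt.trans_le {a b c : Digits} {n : ℕ} (h : FirstLt a b n) (hbc : toLex b ≤ toLex c) :
    LtUpTo (n + 1) a c := by
  rcases hbc.eq_or_lt with e | e
  · exact ⟨n, by omega, (toLex.injective e) ▸ h⟩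
  · obtain ⟨m, hm⟩ := toLex_lt_iff.1 e
    rcases lt_trichotomy m n with hmn | rfl | hmn
    · exact ⟨m, by omega, fun i hi => (h.1 i (hi.trans hmn)).trans (hm.1 i hi),
        (h.1 m hmn).trans hm.2.1, hm.2.2⟩
    · exact absurd h.2.2 (by simp [hm.2.1])
    · exact ⟨n, by omega, fun i hi => (h.1 i hi).trans (hm.1 i (hi.trans hmn)), h.2.1,
        (hm.1 n hmn).symm.trans h.2.2⟩

lemma leUpTo_of_le {a b : Digits} (h : toLex a ≤ toLex b) (n : ℕ) : LeUpTo n a b :=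
  fun _ _ hk => absurd hk.lt (not_lt.2 h)

lemma LeUpTo.mono {a b : Digits} {m n : ℕ} (h : LeUpTo n a b) (hmn : m ≤ n) : LeUpTo m a b :=
  fun k hk => h k (hk.trans_le hmn)

lemma LeUpTo.lt_of_firstLt {a b c : Digits} {n k : ℕ} (h : LeUpTo n a b) (hk : FirstLt b c k)
    (hkn : k < n) : toLex a < toLex c := by
  by_contra hle
  obtain ⟨m, hm, hlt⟩ := hk.trans_le (not_lt.1 hle)
  exact h m (by omega) hlt

lemma LeUpTo.trans_le {a b c : Digits} {n : ℕ} (h : LeUpTo n a b) (hbc : toLex b ≤ toLex c) :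
    LeUpTo n a c := by
  intro k hk hlt
  rcases hbc.eq_or_lt with e | e
  · exact h k hk ((toLex.injective e).symm ▸ hlt)
  · obtain ⟨m, hm⟩ := toLex_lt_iff.1 e
    rcases lt_or_ge m n with hmn | hmn
    · exact absurd (h.lt_of_firstLt hm hmn) (not_lt.2 hlt.lt.le)
    · exact h k hk (hlt.congr (fun i hi => (hm.1 i (by omega)).symm) fun _ _ => rfl)

lemma lt_of_shift_lt {a b : Digits} {n : ℕ} (h : ∀ i < n, a i = b i)
    (hs : toLex (shift n a) < toLex (shift n b)) : toLex a < toLex b := by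
  obtain ⟨k, h1, h2, h3⟩ := toLex_lt_iff.1 hs
  refine FirstLt.lt (n := n + k) ⟨fun i hi => ?_, h2, h3⟩
  rcases lt_or_ge i n with hin | hin
  · exact h i hin
  · have := h1 (i - n) (by omega)
    simpa [shift, Nat.add_sub_cancel' hin] using this

/-- The reflections of all proper suffixes of the word `a₁ … a_M`, and of this word itself, are
strictly smaller than the prefixes of the same length. -/
def Special (a : Digits) (M : ℕ) : Prop :=
  ∀ i < M, LtUpTo (M - i) (reflect (shift i a)) a

lemma Special.last {a : Digits} {M : ℕ} (h : Special a M) (hM : 0 < M) : a (M - 1) = true := by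
  obtain ⟨k, hk, h1, h2, h3⟩ := h (M - 1) (by omega)
  obtain rfl : k = 0 := by omega
  simpa [reflect, shift] using h2

/-- The reflection of `a₁ … a_{M-1}`, followed by the digit `1` and the sequence `F`. -/
def bump (a : Digits) (M : ℕ) (F : Digits) : Digits := glue (reflect a) (M - 1) (cons true F)

lemma bump_of_lt {a F : Digits} {M i : ℕ} (hi : i + 1 < M) : bump a M F i = !a i := by
  simp [bump, glue, reflect, (by omega : i < M - 1)]

lemma bump_last {a F : Digits} {M i : ℕ} (hi : i + 1 = M) : bump a M F i = true := by
  subst hi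
  simp [bump, glue, cons]

lemma bump_add {a F : Digits} {M : ℕ} (hM : 0 < M) (i : ℕ) : bump a M F (M + i) = F i := by
  have h1 : M + i - (M - 1) = i + 1 := by omega
  simp [bump, glue, h1, cons]
  omega

lemma shift_bump {a F : Digits} {M : ℕ} (hM : 0 < M) : shift M (bump a M F) = F :=
  funext fun i => bump_add hM i

/-- The reflected word ends in 0, and `bump` raises this digit to 1; reflected shifts of a are at
least the reflection of a. -/
lemma reflect_lt_shift_bump {a F : Digits} {M i : ℕ} (ha : ∀ n, toLex (shift n a) ≤ toLex a)
    (hM : a (M - 1) = true) (hi : i < M) :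
    toLex (reflect a) < toLex (shift i (bump a M F)) := by
  refine (reflect_le_reflect (ha i)).trans_lt (FirstLt.lt (n := M - 1 - i) ⟨fun j hj => ?_, ?_, ?_⟩)
  · rw [shift, bump_of_lt (by omega)]
    rfl
  · have : i + (M - 1 - i) = M - 1 := by omega
    simp [reflect, shift, this, hM]
  · exact bump_last (by omega)

/-- Only raising the last digit can spoil the inequality given by `Special`. In that case the suffix
becomes a prefix of a, and F has to be compared with the following digits of a. These exceed the
reflection of a within the word, by `Special` at the next index. -/
lemma shift_bump_lt {a F : Digits} {M i : ℕ} (h : Special a M) (hM : 2 ≤ M)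
    (hF : LeUpTo (M - 1) F (reflect a)) (hi : i < M) :
    toLex (shift i (bump a M F)) < toLex a := by
  obtain ⟨j, hj, h1⟩ := h i hi
  rcases Nat.eq_zero_or_pos i with rfl | hi0
  · refine FirstLt.lt (n := 0) ⟨by simp, ?_, ?_⟩
    · obtain ⟨k, hk, h1, h2, h3⟩ := h (M - 1) (by omega)
      obtain rfl : k = 0 := by omega
      simp [bump_of_lt (show 0 + 1 < M by omega), h3]
    · obtain ⟨k, hk, h1, h2, h3⟩ := h (M - 1) (by omega)
      obtain rfl : k = 0 := by omega
      exact h3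
  have e : ∀ l, i + l + 1 < M → shift i (bump a M F) l = reflect (shift i a) l := fun l hl =>
    bump_of_lt hl
  rcases lt_or_ge (i + j + 1) M with hlt | hge
  · exact (h1.congr (fun l hl => (e l (by omega)).symm) fun _ _ => rfl).lt
  · have hj' : i + j + 1 = M := by omega
    refine lt_of_shift_lt (n := j + 1) (fun l hl => ?_) ?_
    · rcases Nat.lt_succ_iff_lt_or_eq.1 hl with hl | rfl
      · rw [e l (by omega), h1.1 l hl]
      · exact (bump_last hj').trans h1.2.2.symm
    · rw [shift_shift, ← add_assoc, hj', shift_bump (by omega)]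
      obtain ⟨k, hk, h2⟩ := h (j + 1) (by omega)
      exact hF.lt_of_firstLt (by simpa using h2.reflect) (by omega)

/-- The periodic sequence whose period is the reflection of `a₁ … a_{M-1}`, followed by `1`. -/
def cyc (a : Digits) (M : ℕ) : Digits := fun i => if i % M + 1 = M then true else !a (i % M)

lemma bump_cyc (a : Digits) {M : ℕ} (hM : 0 < M) : bump a M (cyc a M) = cyc a M := by
  funext i
  rcases lt_or_ge i M with h | h
  · rcases lt_or_ge (i + 1) M with h1 | h1
    · simp [bump_of_lt h1, cyc, Nat.mod_eq_of_lt h, h1.ne]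
    · have h2 : i + 1 = M := by omega
      simp [bump_last h2, cyc, Nat.mod_eq_of_lt h, h2]
  · obtain ⟨j, rfl⟩ := Nat.exists_eq_add_of_le h
    simp [bump_add hM, cyc]

lemma shift_cyc (a : Digits) (M i : ℕ) : shift i (cyc a M) = shift (i % M) (cyc a M) := by
  funext j
  simp [shift, cyc]

lemma cyc_eq_of_lt {a : Digits} {M i : ℕ} (hi : i + 1 < M) : cyc a M i = !a i := by
  rw [← bump_cyc a (by omega), bump_of_lt hi]

lemma leUpTo_of_forall_eq {a b : Digits} {n : ℕ} (h : ∀ i < n, a i = b i) : LeUpTo n a b := by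
  intro k hk hlt
  have := h k hk
  simp [hlt.2.1, hlt.2.2] at this

lemma shift_cyc_mem {a : Digits} {M : ℕ} (ha : ∀ n, toLex (shift n a) ≤ toLex a)
    (h : Special a M) (hM : 2 ≤ M) (i : ℕ) :
    toLex (reflect a) < toLex (shift i (cyc a M)) ∧ toLex (shift i (cyc a M)) < toLex a := by
  have hi : i % M < M := Nat.mod_lt _ (by omega)
  have hF : LeUpTo (M - 1) (cyc a M) (reflect a) :=
    leUpTo_of_forall_eq fun i hi => cyc_eq_of_lt (by omega)
  rw [shift_cyc, ← bump_cyc a (by omega)]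
  exact ⟨reflect_lt_shift_bump ha (h.last (by omega)) hi, shift_bump_lt h hM hF hi⟩

/-- The reflection of a is below that of b, so before place M only the raised digit could violate
the comparison. That would require b to agree with a on M digits, and then `hK` puts the violation
outside the range. Beyond place M the bound for F takes over. -/
lemma leUpTo_bump {a b F : Digits} {M K n N : ℕ} (hb : ∀ n, toLex (shift n b) ≤ toLex b)
    (hba : toLex b < toLex a) (hM : 0 < M) (hK : (∀ i < M, b i = a i) → K ≤ M)
    (hF : LeUpTo n F (reflect b)) (hN : N ≤ n + M) (hNK : N ≤ K - 1) :
    LeUpTo N (bump a M F) (reflect b) := by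
  rintro j hj ⟨h1, h2, h3⟩
  have hbj : b j = true := by simpa [reflect] using h2
  have not : ∀ k, (∀ i < k, b i = a i) → b k = true → a k = false → False := fun k e1 e2 e3 =>
    absurd hba (not_lt.2 (FirstLt.lt ⟨fun i hi => (e1 i hi).symm, e3, e2⟩).le)
  have agree : ∀ i < j, i + 1 < M → b i = a i := by
    intro i hi hiM
    have := h1 i hi
    rw [bump_of_lt hiM] at this
    simpa [reflect] using this
  rcases lt_trichotomy (j + 1) M with hlt | heq | hgt
  · rw [bump_of_lt hlt] at h3
    exact not j (fun i hi => agree i hi (by omega)) hbj (by simpa using h3)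
  · cases haj : a j with
    | true =>
      have : K ≤ M := hK fun i hi => by
        rcases Nat.lt_or_ge i j with h | h
        · exact agree i h (by omega)
        · obtain rfl : i = j := by omega
          rw [hbj, haj]
      omega
    | false => exact not j (fun i hi => agree i hi (by omega)) hbj haj
  · have hF' := hF.trans_le (reflect_le_reflect (hb M))
    obtain ⟨l, rfl⟩ := Nat.exists_eq_add_of_le (show M ≤ j by omega)
    refine hF' l (by omega) ⟨fun i hi => ?_, h2, by rwa [bump_add hM] at h3⟩
    have := h1 (M + i) (by omega)
    rwa [bump_add hM] at this

/-- `cyc a M` is a fixed point of `bump a M`, so each application of `leUpTo_bump` lengthens the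
range of validity. -/
lemma leUpTo_cyc {a b : Digits} {M K : ℕ} (hb : ∀ n, toLex (shift n b) ≤ toLex b)
    (hba : toLex b < toLex a) (hM : 0 < M) (hK : (∀ i < M, b i = a i) → K ≤ M) :
    LeUpTo (K - 1) (cyc a M) (reflect b) := by
  have : ∀ n, n ≤ K - 1 → LeUpTo n (cyc a M) (reflect b) := by
    intro n
    induction n with
    | zero => exact fun _ k hk => absurd hk (Nat.not_lt_zero k)
    | succ n ih =>
      intro hn
      rw [← bump_cyc a hM]
      exact leUpTo_bump hb hba hM hK (ih (by omega)) (by omega) hn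
  exact this _ le_rfl

/-- If the prefix of length N fails, it is extended to where the comparison at the first failing
index k is decided. Later suffixes inherit this decision, because shifts of a are at most a. -/
lemma exists_special {a : Digits} (ha : ∀ n, toLex (shift n a) ≤ toLex a)
    (h : ∀ n, toLex (reflect a) < toLex (shift n a)) (N : ℕ) : ∃ M, N ≤ M ∧ Special a M := by
  classical
  have h' : ∀ n, ∃ j, FirstLt (reflect (shift n a)) a j := fun n => by
    have := reflect_lt_reflect (h n)
    rw [reflect_reflect] at this
    exact toLex_lt_iff.1 this
  by_cases hK : ∃ k, k < N ∧ ¬LtUpTo (N - k) (reflect (shift k a)) a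
  · set k := Nat.find hK with hk
    obtain ⟨hkN, hkk⟩ := Nat.find_spec hK
    rw [← hk] at hkN hkk
    obtain ⟨j, hj⟩ := h' k
    have hjN : N - k ≤ j := by
      by_contra hlt
      exact hkk ⟨j, not_le.1 hlt, hj⟩
    refine ⟨k + j + 1, by omega, fun i hi => ?_⟩
    rcases lt_trichotomy i k with hik | hik | hik
    · have := Nat.find_min hK hik
      have hiN : i < N := by omega
      simp only [hiN, true_and, not_not] at this
      obtain ⟨l, hl, hl'⟩ := this
      exact ⟨l, by omega, hl'⟩
    · rw [hik]
      exact ⟨j, by omega, hj⟩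
    · have h1 : FirstLt (reflect (shift i a)) (shift (i - k) a) (j - (i - k)) := by
        have e : ∀ l, reflect (shift i a) l = reflect (shift k a) (i - k + l) := fun l => by
          simp only [reflect, shift]
          congr 2
          omega
        have e2 : i - k + (j - (i - k)) = j := by omega
        refine ⟨fun l hl => ?_, ?_, ?_⟩
        · rw [e, hj.1 _ (by omega)]
          rfl
        · rw [e, e2, hj.2.1]
        · rw [shift, e2, hj.2.2]
      obtain ⟨l, hl, hl'⟩ := h1.trans_le (ha (i - k))
      exact ⟨l, by omega, hl'⟩
  · push Not at hK
    exact ⟨N, le_rfl, hK⟩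

/-- A comparison undecided before place M would make the reflected tail from M smaller than a shift
of a, hence smaller than a, against `hM`. -/
lemma special_of_forall_not {a : Digits} {M : ℕ} (ha : ∀ n, toLex (shift n a) ≤ toLex a)
    (hM : toLex (shift M a) ≤ toLex (reflect a))
    (hmin : ∀ i < M, ¬toLex (shift i a) ≤ toLex (reflect a)) : Special a M := by
  intro i hi
  have h1 : toLex (reflect (shift i a)) < toLex a := by
    have := reflect_lt_reflect (not_le.1 (hmin i hi))
    rwa [reflect_reflect] at this
  obtain ⟨j, hj⟩ := toLex_lt_iff.1 h1
  rcases lt_or_ge j (M - i) with hlt | hge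
  · exact ⟨j, hlt, hj⟩
  · have h2 := shift_lt_shift h1 (n := M - i) fun l hl => hj.1 l (by omega)
    rw [← reflect_shift, shift_shift, Nat.add_sub_cancel' hi.le] at h2
    have h3 := reflect_le_reflect hM
    rw [reflect_reflect] at h3
    exact absurd (h2.trans_le (ha _)) (not_lt.2 h3)

/-! ### The closure of U in terms of quasi-greedy expansions -/

lemma val_glue_cons {q : ℝ} (hq : 1 < q) (d : Digits) (n : ℕ) (b : Bool) (e : Digits) :
    val q (glue d n (cons b e)) =
      pre q d n + ((if b then (1 : ℝ) else 0) + val q e) / q ^ (n + 1) := by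
  rw [val_glue hq, val_cons hq, div_div, ← pow_succ']

lemma not_mem_univoqueBases_of_val {q y : ℝ} (d : Digits) (n : ℕ)
    (h1 : val q (glue d n (cons true zeros)) ≤ y) (h2 : y ≤ val q (glue d n (cons false ones))) :
    q ∉ univoqueBases y := by
  intro hmem
  have hq := hmem.1.1
  rw [val_glue_cons hq, val_zeros] at h1
  rw [val_glue_cons hq, val_ones hq] at h2
  simp only [if_true, add_zero, Bool.false_eq_true, if_false, zero_add] at h1 h2
  exact not_mem_univoqueBases d n h1 h2 hmem

lemma IsQG.infZeros {q : ℝ} (hq : 1 < q) (hq2 : q < 2) {a : Digits} (ha : IsQG q a) :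
    InfOnes (reflect a) := by
  intro n
  by_contra hno
  push Not at hno
  have : shift n a = ones := by
    funext i
    simpa [reflect, shift, ones] using hno (n + i) (by omega)
  have h := ha.shift_val_le n
  rw [this, val_ones hq, div_le_one (by linarith)] at h
  linarith

lemma IsQG.val_eq_glue {q : ℝ} (hq : 1 < q) {a : Digits} (ha : IsQG q a) {n : ℕ} :
    pre q a n + ((if a n then (1 : ℝ) else 0) + val q (shift (n + 1) a)) / q ^ (n + 1) = 1 := by
  rw [add_div, ← add_assoc, ← pre_succ, ← val_eq_pre_add hq, ha.val_eq]

/-- The tail after the digit 1 at M is worth at most 1 / (q - 1) - 1, so replacing 1 and this tail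
by 01^∞ does not lower the value. -/
lemma IsQG.one_le_val_glue {q : ℝ} (hq : 1 < q) {a : Digits} (ha : IsQG q a) {M : ℕ}
    (haM : a M = true) (h : toLex (shift (M + 1) a) ≤ toLex (reflect a)) :
    1 ≤ val q (glue a M (cons false ones)) := by
  have h1 := ha.val_eq_glue hq (n := M)
  have h2 := reflect_le_reflect h
  rw [reflect_reflect] at h2
  have h3 := ha.one_le_val hq h2
  rw [val_reflect hq] at h3
  rw [haM] at h1
  refine h1.symm.trans_le ?_
  rw [val_glue_cons hq, val_ones hq]
  simp only [if_true, Bool.false_eq_true, if_false, zero_add]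
  gcongr
  linarith

lemma IsQG.one_lt_val_glue {q : ℝ} (hq : 1 < q) (hq2 : q < 2) {a : Digits} (ha : IsQG q a) {M : ℕ}
    (haM : a M = true) (h : toLex (shift (M + 1) a) < toLex (reflect a)) :
    1 < val q (glue a M (cons false ones)) := by
  have h1 := ha.val_eq_glue hq (n := M)
  have h2 := reflect_lt_reflect h
  rw [reflect_reflect] at h2
  have h3 := ha.one_lt_val hq h2 ((ha.infZeros hq hq2).shift (M + 1))
  rw [val_reflect hq] at h3
  rw [haM] at h1
  refine h1.symm.trans_lt ?_
  rw [val_glue_cons hq, val_ones hq]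
  simp only [if_true, Bool.false_eq_true, if_false, zero_add]
  gcongr
  linarith

lemma IsQG.val_glue_lt_one {q : ℝ} (hq : 1 < q) {a : Digits} (ha : IsQG q a) {M : ℕ}
    (haM : a M = true) : val q (glue a M (cons true zeros)) < 1 := by
  have h1 := ha.val_eq_glue hq (n := M)
  have h2 := ha.inf.shift_val_pos hq (M + 1)
  rw [haM] at h1
  refine lt_of_lt_of_eq ?_ h1
  rw [val_glue_cons hq, val_zeros]
  simp only [if_true]
  gcongr

lemma continuousAt_val (d : Digits) {q : ℝ} (hq : 1 < q) : ContinuousAt (fun r => val r d) q :=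
  (continuousOn_val d (r := (1 + q) / 2) (by linarith)).continuousAt
    (Ici_mem_nhds (by linarith))

lemma exists_special_of_le {q : ℝ} (hq : Real.goldenRatio < q) {a : Digits}
    (ha : IsQG q a) (h : ∃ n, toLex (shift n a) ≤ toLex (reflect a)) :
    ∃ M, 2 ≤ M ∧ Special a M ∧ toLex (shift M a) ≤ toLex (reflect a) ∧
      ∀ i < M, ¬toLex (shift i a) ≤ toLex (reflect a) := by
  classical
  have hq1 : 1 < q := Real.one_lt_goldenRatio.trans hq
  have h0 := ha.zero hq1
  have hmin : ∀ i < Nat.find h, ¬toLex (shift i a) ≤ toLex (reflect a) :=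
    fun i hi => Nat.find_min h hi
  refine ⟨Nat.find h, ?_, special_of_forall_not (ha.shift_le hq1) (Nat.find_spec h) hmin,
    Nat.find_spec h, hmin⟩
  -- The reflection of a starts with 0, so the two leading digits 1 of a rule out the indices 0 and
  -- 1.
  have aux : ∀ n, a n = true → Nat.find h ≠ n := by
    rintro n hn rfl
    have := toLex_le_zero (Nat.find_spec h) (by simpa [shift] using hn)
    simp [reflect, h0] at this
  have := aux 0 h0
  have := aux 1 (ha.one hq)
  omega

/-- In base q the number 1 lies in a switch interval after a prefix of `alpha q`, and by continuity
this excludes all nearby bases. -/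
lemma not_mem_closure_U {q : ℝ} (hq : Real.goldenRatio < q) (hq2 : q < 2)
    (h : ∃ n, toLex (shift n (alpha q)) ≤ toLex (reflect (alpha q))) : q ∉ closure U := by
  have hq1 : 1 < q := Real.one_lt_goldenRatio.trans hq
  have ha := isQG_alpha hq1 hq2.le
  set a := alpha q with hadef
  obtain ⟨M, hM2, hsp, hM, hmin⟩ := exists_special_of_le hq ha h
  obtain ⟨M, rfl⟩ := Nat.exists_eq_add_of_le (show 1 ≤ M by omega)
  rw [add_comm] at hM hsp
  have haM : a M = true := hsp.last (by omega)
  rw [mem_closure_iff_frequently, not_frequently]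
  have hB : val q (glue a M (cons true zeros)) < 1 := ha.val_glue_lt_one hq1 haM
  have hB' := (continuousAt_val (glue a M (cons true zeros)) hq1).eventually_lt_const hB
  rcases hM.lt_or_eq with hlt | heq
  · have hA := ha.one_lt_val_glue hq1 hq2 haM hlt
    filter_upwards [hB', (continuousAt_val _ hq1).eventually_const_lt hA] with r h1 h2
    exact not_mem_univoqueBases_of_val a M h1.le h2.le
  -- Now 1 may be the upper end of the interval, which serves only bases up to q. Since a has period
  -- 2M + 2 and its period ends in 0, the interval after 2M + 1 digits has 1 as its lower end and
  -- serves the bases from q on.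
  · have heq' : shift (M + 1) a = reflect a := toLex.injective heq
    have hA := ha.one_le_val_glue hq1 haM hM
    have h0 : a (2 * M + 1) = false := by
      have := congrFun heq' M
      simpa [shift, reflect, haM, (by ring : M + 1 + M = 2 * M + 1)] using this
    have hsh : shift (2 * M + 1 + 1) a = a := by
      have : 2 * M + 1 + 1 = M + 1 + (M + 1) := by ring
      rw [this, ← shift_shift, heq', ← reflect_shift, heq', reflect_reflect]
    have h1 := ha.val_eq_glue hq1 (n := 2 * M + 1)
    rw [hsh, ha.val_eq, h0] at h1
    simp only [Bool.false_eq_true, if_false, zero_add] at h1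
    have hC : val q (glue a (2 * M + 1) (cons true zeros)) = 1 := by
      refine Eq.trans ?_ h1
      rw [val_glue_cons hq1, val_zeros]
      simp
    have hD : 1 < val q (glue a (2 * M + 1) (cons false ones)) := by
      refine h1.symm.trans_lt ?_
      rw [val_glue_cons hq1, val_ones hq1]
      simp only [Bool.false_eq_true, if_false, zero_add]
      have : 1 < 1 / (q - 1) := by
        rw [lt_div_iff₀ (by linarith)]
        linarith
      gcongr
    filter_upwards [hB', (continuousAt_val _ hq1).eventually_const_lt hD,
      lt_mem_nhds hq1] with r h2 h3 h4
    rcases le_total r q with hrq | hrq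
    · exact not_mem_univoqueBases_of_val a M h2.le (hA.trans (val_anti h4 hrq _))
    · exact not_mem_univoqueBases_of_val a (2 * M + 1) ((val_anti hq1 hrq _).trans_eq hC) h3.le

/-- Used with N = M for shifts inside the long first word of E and with N = m for its periodic tail.
The bound 2t + 1 leaves room for two successive comparisons of at most t digits, one on each side of
the raised digit. -/
lemma bump_interior {a G : Digits} {t m M N k : ℕ} (ha : ∀ n, toLex (shift n a) ≤ toLex a)
    (ht : ∀ j, LtUpTo t (reflect (shift j a)) a) (hG : ∀ i, i + 1 < m → G i = !a i)
    (hm : 2 * t + 1 ≤ m) (hN : Special a N) (hmN : m ≤ N) (hNM : N ≤ M) (hk : k < N)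
    (hkM : 1 ≤ k ∨ N < M) {E : Digits} (hE : ∀ i, i + 1 < M → E i = !a i) :
    toLex E < toLex (shift k (bump a N G)) ∧ toLex (shift k (bump a N G)) < toLex (reflect E) := by
  have e : ∀ l, k + l + 1 < N → shift k (bump a N G) l = reflect (shift k a) l := fun l hl =>
    bump_of_lt hl
  constructor
  · have h1 : FirstLt (reflect (shift k a)) (shift k (bump a N G)) (N - 1 - k) := by
      refine ⟨fun l hl => (e l (by omega)).symm, ?_, bump_last (by omega)⟩
      have : k + (N - 1 - k) = N - 1 := by omega
      simp [reflect, shift, this, hN.last (by omega)]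
    obtain ⟨l, hl, h2⟩ := h1.reflect.trans_le (c := a) (by simpa using ha k)
    have h3 := h2.reflect
    rw [reflect_reflect] at h3
    exact (h3.congr (c := E) (fun i hi => (hE i (by omega)).symm) fun _ _ => rfl).lt
  · have hE' : ∀ i, i + 1 < M → a i = reflect E i := fun i hi => by simp [reflect, hE i hi]
    obtain ⟨l, hl, h1⟩ := ht k
    rcases lt_or_ge (k + t) N with hkt | hkt
    · exact (h1.congr (fun i hi => (e i (by omega)).symm) fun i hi => hE' i (by omega)).lt
    · obtain ⟨j, hj, h2⟩ := hN k hk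
      rcases lt_or_ge (k + j + 1) N with hlt | hge
      · exact (h2.congr (fun i hi => (e i (by omega)).symm) fun i hi => hE' i (by omega)).lt
      · have hj' : k + j + 1 = N := by omega
        refine lt_of_shift_lt (n := j + 1) (fun i hi => ?_) ?_
        · rw [← hE' i (by omega)]
          rcases Nat.lt_succ_iff_lt_or_eq.1 hi with hi | rfl
          · rw [e i (by omega), h2.1 i hi]
          · exact (bump_last hj').trans h2.2.2.symm
        · rw [shift_shift, ← add_assoc, hj', shift_bump (by omega)]
          obtain ⟨s, hs, h3⟩ := ht (j + 1)
          have h4 := h3.reflect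
          rw [reflect_reflect] at h4
          exact (h4.congr (fun i hi => (hG i (by omega)).symm) fun i hi => hE' _ (by omega)).lt

/-- If `alpha q` is not periodic, it is the unique expansion of 1. If it is periodic, long prefixes
are continued by a fixed reflected periodic sequence; the result is the unique expansion of 1 in a
base close to q. -/
lemma mem_closure_U {q : ℝ} (hq : 1 < q) (hq2 : q < 2)
    (h : ∀ n, toLex (reflect (alpha q)) < toLex (shift n (alpha q))) : q ∈ closure U := by
  have ha := isQG_alpha hq hq2.le
  set a := alpha q with hadef
  have hle := ha.shift_le hq
  by_cases hper : ∀ n, 1 ≤ n → shift n a ≠ a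
  · refine subset_closure (LexUnivoque.mem hq hq2.le ha.val_eq.le ha.inf (fun i => ⟨fun _ => ?_,
      fun _ => h (i + 1)⟩) ha.val_eq)
    exact lt_of_le_of_ne (hle _) fun e => hper (i + 1) (by omega) (toLex.injective e)
  push Not at hper
  obtain ⟨P, hP, hPa⟩ := hper
  have hmod : ∀ j, shift j a = shift (j % P) a := by
    intro j
    induction j using Nat.strong_induction_on with
    | _ j ih =>
      rcases lt_or_ge j P with hj | hj
      · rw [Nat.mod_eq_of_lt hj]
      · obtain ⟨i, rfl⟩ := Nat.exists_eq_add_of_le hj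
        rw [← shift_shift, hPa, ih i (by omega), Nat.add_mod_left]
  have hf : ∀ j, ∃ k, FirstLt (reflect (shift j a)) a k := fun j => by
    have := reflect_lt_reflect (h j)
    rw [reflect_reflect] at this
    exact toLex_lt_iff.1 this
  choose f hf using hf
  -- By periodicity there are only finitely many shifts, so one length t decides all the
  -- comparisons.
  set t := (Finset.range P).sup f + 1 with htdef
  have ht : ∀ j, LtUpTo t (reflect (shift j a)) a := by
    intro j
    rw [hmod j]
    refine ⟨f (j % P), ?_, hf _⟩
    exact Nat.lt_succ_of_le (Finset.le_sup (Finset.mem_range.2 (Nat.mod_lt _ hP)))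
  obtain ⟨m, hm, hsm⟩ := exists_special hle h (2 * t + 1)
  set G := cyc a m with hG
  have hG' : ∀ i, i + 1 < m → G i = !a i := fun i hi => cyc_eq_of_lt hi
  rw [Metric.mem_closure_iff]
  intro δ hδ
  have ha0 := ha.zero hq
  obtain ⟨N, ε, hε, hN⟩ := exists_base_near ha0 hq ha.val_eq (lt_min hδ (sub_pos.2 hq2))
  obtain ⟨M, hM, hsM⟩ := exists_special hle h (max (m + 1) (N + 1))
  have hM1 : m + 1 ≤ M := (le_max_left _ _).trans hM
  have hM2 : N + 1 ≤ M := (le_max_right _ _).trans hM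
  set E := bump a M G with hEdef
  have hE : ∀ i, i + 1 < M → E i = !a i := fun i hi => bump_of_lt hi
  obtain ⟨p, hp1, hp, hpv⟩ := hN (reflect E) (fun i hi => by simp [reflect, hE i (by omega)]) 1
    (by simpa using hε)
  have hp' := abs_lt.1 hp
  refine ⟨p, LexUnivoque.mem hp1 ?_ (c := reflect E) hpv.le ?_ ?_ hpv, ?_⟩
  · linarith [min_le_right δ (2 - q)]
  · intro n
    refine ⟨M + m * n, ?_, ?_⟩
    · have : 1 * n ≤ m * n := Nat.mul_le_mul_right _ (by omega)
      omega
    · have h1 : G (m * n) = !a 0 := by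
        rw [hG, ← cyc_eq_of_lt (show 0 + 1 < m by omega)]
        simp [cyc]
      rw [reflect, hEdef, bump_add (by omega), h1, ha0]
      rfl
  · have key : ∀ i, toLex E < toLex (shift (i + 1) E) ∧
        toLex (shift (i + 1) E) < toLex (reflect E) := by
      intro i
      rcases lt_or_ge (i + 1) M with hi | hi
      · exact bump_interior hle ht hG' hm hsM (by omega) le_rfl hi (Or.inl (by omega)) hE
      · obtain ⟨r, hr⟩ := Nat.exists_eq_add_of_le hi
        have h1 : shift (i + 1) E = shift (r % m) (bump a m G) := by
          rw [hr, ← shift_shift, hEdef, shift_bump (by omega), hG, bump_cyc a (by omega),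
            ← shift_cyc]
        rw [h1]
        exact bump_interior hle ht hG' hm hsm le_rfl (by omega) (Nat.mod_lt _ (by omega))
          (Or.inr (by omega)) hE
    intro i
    rw [reflect_reflect, ← reflect_shift]
    refine ⟨fun _ => reflect_lt_reflect (key i).1, fun _ => ?_⟩
    have := reflect_lt_reflect (key i).2
    rwa [reflect_reflect] at this
  · rw [Real.dist_eq, abs_sub_comm]
    exact hp.trans_le (min_le_left _ _)

lemma exists_block {q : ℝ} (hq : Real.goldenRatio < q) (hq2 : q < 2) (hU : q ∉ closure U) :
    ∃ M, blockIndex q = M + 1 ∧ 2 ≤ M ∧ Special (alpha q) M ∧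
      toLex (shift M (alpha q)) ≤ toLex (reflect (alpha q)) := by
  have hq1 : 1 < q := Real.one_lt_goldenRatio.trans hq
  have h : ∃ n, toLex (shift n (alpha q)) ≤ toLex (reflect (alpha q)) := by
    by_contra hno
    push Not at hno
    exact hU (mem_closure_U hq1 hq2 hno)
  obtain ⟨M, h1, h2, h3, h4⟩ := exists_special_of_le hq (isQG_alpha hq1 hq2.le) h
  refine ⟨M, ?_, h1, h2, h3⟩
  have hmem : ∀ n, M + 1 ≤ n + 1 ∨ ¬toLex (alpha q) ≤ toLex (reflect (shift n (alpha q))) := by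
    intro n
    rcases le_or_gt M n with hn | hn
    · exact Or.inl (by omega)
    · refine Or.inr fun hle => h4 n hn ?_
      have := reflect_le_reflect hle
      rwa [reflect_reflect] at this
  refine IsLeast.csInf_eq ⟨⟨by omega, ?_⟩, fun n hn => ?_⟩
  · have := reflect_le_reflect h3
    rwa [reflect_reflect] at this
  · obtain ⟨n, rfl⟩ := Nat.exists_eq_add_of_le hn.1
    rcases hmem n with h5 | h5
    · omega
    · exact absurd hn.2 (by simpa using h5)

lemma mem_V_iff_of_special {q : ℝ} (hq : 1 < q) (hq2 : q ≤ 2) {M : ℕ}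
    (hmin : ∀ i < M, toLex (reflect (alpha q)) ≤ toLex (shift i (alpha q)))
    (hM : toLex (shift M (alpha q)) ≤ toLex (reflect (alpha q))) :
    q ∈ V ↔ shift M (alpha q) = reflect (alpha q) := by
  have ha := (isQG_alpha hq hq2).shift_le hq
  constructor
  · exact fun h => toLex.injective (le_antisymm hM (h.2 M).1)
  · refine fun h => ⟨⟨hq, hq2⟩, fun n => ⟨?_, ha n⟩⟩
    rcases lt_or_ge n M with hn | hn
    · exact hmin n hn
    · obtain ⟨k, rfl⟩ := Nat.exists_eq_add_of_le hn
      rw [← shift_shift, h, ← reflect_shift]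
      exact reflect_le_reflect (ha k)

/-! ### Words of the algorithm and their switch intervals -/

lemma reflect_glue (d : Digits) (n : ℕ) (e : Digits) :
    reflect (glue d n e) = glue (reflect d) n (reflect e) := by
  funext i
  by_cases h : i < n <;> simp [reflect, glue, h]

lemma reflect_cons (b : Bool) (d : Digits) : reflect (cons b d) = cons (!b) (reflect d) := by
  funext i
  cases i <;> rfl

@[simp] lemma reflect_ones : reflect ones = zeros := rfl

@[simp] lemma reflect_zeros : reflect zeros = ones := rfl

lemma zeroOnes_eq : zeroOnes = cons false ones := by
  funext i
  cases i <;> simp [zeroOnes, cons, ones]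

lemma prepend_eq_glue (w : List Bool) (d : Digits) :
    prepend w d = glue (prepend w zeros) w.length d := by
  funext i
  by_cases h : i < w.length <;> simp [prepend, glue, h]

lemma prepend_append (u v : List Bool) (d : Digits) :
    prepend (u ++ v) d = prepend u (prepend v d) := by
  funext i
  simp only [prepend, List.length_append]
  by_cases h : i < u.length
  · simp [h, List.getElem_append_left h, (by omega : i < u.length + v.length)]
  · have h' := not_lt.1 h
    by_cases h2 : i < u.length + v.length
    · have h3 : i - u.length < v.length := by omega
      simp [h, h2, h3, List.getElem_append_right h']
    · have h3 : ¬i - u.length < v.length := by omega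
      simp [h, h2, h3, Nat.sub_sub]

lemma prepend_block {q : ℝ} {M : ℕ} (hM : blockIndex q = M + 1 + 1) (d : Digits) :
    prepend (block q) d = cons true (glue (reflect (alpha q)) M d) := by
  funext i
  have hlen : (block q).length = M + 1 := by simp [block, hM]
  cases i with
  | zero => simp [prepend, block, cons]
  | succ i =>
    by_cases h : i < M
    · have h' : i + 1 < (block q).length := by omega
      simp only [prepend, h', dite_true, cons, glue, h, if_true]
      simp [block]
    · have h' : ¬i + 1 < (block q).length := by omega
      simp only [prepend, h', dite_false, cons, glue, h, if_false]
      congr 1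
      omega

lemma val_prepend_cons {q : ℝ} (hq : 1 < q) (w : List Bool) (b : Bool) (d : Digits) :
    val q (prepend w (cons b d)) = pre q (prepend w zeros) w.length +
      ((if b then (1 : ℝ) else 0) + val q d) / q ^ (w.length + 1) := by
  rw [prepend_eq_glue, val_glue_cons hq]

/-- The word `0^(m-1) B_1 … B_k` of the algorithm. -/
def word (x : ℝ) (k : ℕ) : List Bool := (algorithm x k).1

/-- The value in base `q` of the word of the algorithm, followed by `01^∞`. -/
def upperVal (x : ℝ) (k : ℕ) (q : ℝ) : ℝ := val q (prepend (word x k) (cons false ones))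

/-- The value in base `q` of the word of the algorithm, followed by `10^∞`. -/
def lowerVal (x : ℝ) (k : ℕ) (q : ℝ) : ℝ := val q (prepend (word x k) (cons true zeros))

lemma word_zero (x : ℝ) : word x 0 = List.replicate (level x - 1) false := rfl

lemma word_succ (x : ℝ) (k : ℕ) : word x (k + 1) = word x k ++ block (lowerBound x k) := rfl

lemma lowerBound_zero (x : ℝ) : lowerBound x 0 = qStar x := rfl

lemma lowerBound_succ (x : ℝ) (k : ℕ) :
    lowerBound x (k + 1) = baseOf x (prepend (word x (k + 1)) (cons false ones)) := by
  rw [← zeroOnes_eq]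
  rfl

lemma prepend_cons_length (w : List Bool) (b : Bool) (d : Digits) :
    prepend w (cons b d) w.length = b := by
  simp [prepend, cons]

lemma prepend_cons_ones_length (w : List Bool) :
    prepend w (cons false ones) (w.length + 1) = true := by
  simp [prepend, cons, ones]

lemma upperVal_strictAnti {x : ℝ} {k : ℕ} {q r : ℝ} (hq : 1 < q) (hqr : q < r) :
    upperVal x k r < upperVal x k q :=
  val_strictAnti hq hqr (prepend_cons_ones_length _)

lemma lowerVal_strictAnti {x : ℝ} {k : ℕ} {q r : ℝ} (hq : 1 < q) (hqr : q < r) :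
    lowerVal x k r < lowerVal x k q :=
  val_strictAnti hq hqr (prepend_cons_length _ _ _)

lemma upperVal_two (x : ℝ) (k : ℕ) : upperVal x k 2 = lowerVal x k 2 := by
  have h : (1 : ℝ) < 2 := by norm_num
  rw [upperVal, lowerVal, val_prepend_cons h, val_prepend_cons h, val_ones h, val_zeros]
  norm_num

lemma val_prepend_reflect_alpha {q : ℝ} (hq : 1 < q) (hq2 : q ≤ 2) (w : List Bool) :
    val q (prepend w (cons true (reflect (alpha q)))) = val q (prepend w (cons false ones)) := by
  rw [val_prepend_cons hq, val_prepend_cons hq, val_ones hq, val_reflect hq,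
    (isQG_alpha hq hq2).val_eq]
  simp

/-- The new block followed by 10^∞ is 1 followed by the reflection of a₁…a_M01^∞, where a is `alpha
(lowerBound x k)`. The overlap of consecutive intervals is thereby reduced to comparing a switch
endpoint for the number 1 with 1. -/
lemma lowerVal_succ {x : ℝ} {k M : ℕ} (hM : blockIndex (lowerBound x k) = M + 1 + 1) {q : ℝ}
    (hq : 1 < q) : lowerVal x (k + 1) q = upperVal x k q + (1 -
      val q (glue (alpha (lowerBound x k)) M (cons false ones))) / q ^ ((word x k).length + 1) := by
  have e : glue (reflect (alpha (lowerBound x k))) M (cons true zeros) =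
      reflect (glue (alpha (lowerBound x k)) M (cons false ones)) := by
    rw [reflect_glue, reflect_cons]
    rfl
  rw [lowerVal, upperVal, word_succ, prepend_append, prepend_block hM, e, val_prepend_cons hq,
    val_prepend_cons hq, val_reflect hq, val_ones hq]
  simp only [if_true, Bool.false_eq_true, if_false]
  ring

lemma upperVal_succ {x : ℝ} {k M : ℕ} (hM : blockIndex (lowerBound x k) = M + 1 + 1) {q : ℝ}
    (hq : 1 < q) : upperVal x (k + 1) q = upperVal x k q + (1 -
      val q (glue (alpha (lowerBound x k)) M (cons true zeros))) / q ^ ((word x k).length + 1) := by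
  have e : glue (reflect (alpha (lowerBound x k))) M (cons false ones) =
      reflect (glue (alpha (lowerBound x k)) M (cons true zeros)) := by
    rw [reflect_glue, reflect_cons]
    rfl
  rw [upperVal, upperVal, word_succ, prepend_append, prepend_block hM, e, val_prepend_cons hq,
    val_prepend_cons hq, val_reflect hq, val_ones hq]
  simp only [if_true, Bool.false_eq_true, if_false]
  ring

lemma lowerVal_succ_le {x : ℝ} {k : ℕ} (hq : Real.goldenRatio < lowerBound x k)
    (hq2 : lowerBound x k < 2) (hU : lowerBound x k ∉ closure U) {r : ℝ} (hr : 1 < r)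
    (hrq : r ≤ lowerBound x k) : lowerVal x (k + 1) r ≤ upperVal x k r := by
  have hq1 := Real.one_lt_goldenRatio.trans hq
  obtain ⟨M, hb, hM2, hsp, hM⟩ := exists_block hq hq2 hU
  obtain ⟨M, rfl⟩ := Nat.exists_eq_add_of_le' (show 1 ≤ M by omega)
  have h1 := (isQG_alpha hq1 hq2.le).one_le_val_glue hq1 (M := M) (hsp.last (by omega)) hM
  have h2 := val_anti hr hrq (glue (alpha (lowerBound x k)) M (cons false ones))
  rw [lowerVal_succ hb hr]
  have : (1 - val r (glue (alpha (lowerBound x k)) M (cons false ones))) /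
      r ^ ((word x k).length + 1) ≤ 0 :=
    div_nonpos_of_nonpos_of_nonneg (by linarith) (by positivity)
  linarith

lemma lowerVal_succ_lt {x : ℝ} {k : ℕ} (hq : Real.goldenRatio < lowerBound x k)
    (hq2 : lowerBound x k < 2) (hU : lowerBound x k ∉ closure U) (hV : lowerBound x k ∉ V) :
    lowerVal x (k + 1) (lowerBound x k) < upperVal x k (lowerBound x k) := by
  have hq1 := Real.one_lt_goldenRatio.trans hq
  obtain ⟨M, hb, hM2, hsp, hM⟩ := exists_block hq hq2 hU
  have hmin : ∀ i < M, toLex (reflect (alpha (lowerBound x k))) ≤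
      toLex (shift i (alpha (lowerBound x k))) := fun i hi => by
    obtain ⟨j, _, hj⟩ := hsp i hi
    have := hj.reflect.lt.le
    rwa [reflect_reflect] at this
  have hne : shift M (alpha (lowerBound x k)) ≠ reflect (alpha (lowerBound x k)) := fun h =>
    hV ((mem_V_iff_of_special hq1 hq2.le hmin hM).2 h)
  have hlt := lt_of_le_of_ne hM fun h => hne (toLex.injective h)
  obtain ⟨M, rfl⟩ := Nat.exists_eq_add_of_le' (show 1 ≤ M by omega)
  have h1 := (isQG_alpha hq1 hq2.le).one_lt_val_glue hq1 hq2 (M := M) (hsp.last (by omega)) hlt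
  rw [lowerVal_succ hb hq1]
  have : (1 - val (lowerBound x k) (glue (alpha (lowerBound x k)) M (cons false ones))) /
      lowerBound x k ^ ((word x k).length + 1) < 0 :=
    div_neg_of_neg_of_pos (by linarith) (by positivity)
  linarith

lemma lt_upperVal_succ {x : ℝ} {k : ℕ} (hq : Real.goldenRatio < lowerBound x k)
    (hq2 : lowerBound x k < 2) (hU : lowerBound x k ∉ closure U) :
    upperVal x k (lowerBound x k) < upperVal x (k + 1) (lowerBound x k) := by
  have hq1 := Real.one_lt_goldenRatio.trans hq
  obtain ⟨M, hb, hM2, hsp, hM⟩ := exists_block hq hq2 hU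
  obtain ⟨M, rfl⟩ := Nat.exists_eq_add_of_le' (show 1 ≤ M by omega)
  have h1 := (isQG_alpha hq1 hq2.le).val_glue_lt_one hq1 (M := M) (hsp.last (by omega))
  rw [upperVal_succ hb hq1]
  have : 0 < (1 - val (lowerBound x k) (glue (alpha (lowerBound x k)) M (cons true zeros))) /
      lowerBound x k ^ ((word x k).length + 1) :=
    div_pos (by linarith) (by positivity)
  linarith

/-! ### Existence and monotonicity of the lower bounds -/

lemma level_spec {x : ℝ} (hx0 : 0 < x) (hx1 : x < 1)
    (hx : ∀ m : ℕ, x ≠ Real.goldenRatio ^ (-(m : ℤ))) :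
    1 ≤ level x ∧ (Real.goldenRatio ^ level x)⁻¹ < x ∧
      x < Real.goldenRatio / Real.goldenRatio ^ level x := by
  have hg := Real.one_lt_goldenRatio
  have hg0 : 0 < Real.goldenRatio := by linarith
  have hex : ∃ m : ℕ, 1 ≤ m ∧ Real.goldenRatio ^ (-(m : ℤ)) ≤ x ∧
      x < Real.goldenRatio ^ (-(m : ℤ) + 1) := by
    obtain ⟨n, h1, h2⟩ := exists_nat_pow_near_of_lt_one hx0 hx1.le (inv_pos.2 hg0)
      (inv_lt_one_of_one_lt₀ hg)
    refine ⟨n + 1, by omega, ?_, ?_⟩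
    · rw [zpow_neg, zpow_natCast, ← inv_pow]
      exact h1.le
    · refine lt_of_le_of_ne (h2.trans_eq ?_) ?_
      · rw [inv_pow, ← zpow_natCast, ← zpow_neg]
        congr 1
        push_cast
        ring
      · have := hx n
        rwa [show (-((n + 1 : ℕ) : ℤ) + 1) = -(n : ℤ) by push_cast; ring]
  obtain ⟨h1, h2, h3⟩ := Classical.epsilon_spec hex
  change 1 ≤ level x at h1
  change Real.goldenRatio ^ (-(level x : ℤ)) ≤ x at h2
  change x < Real.goldenRatio ^ (-(level x : ℤ) + 1) at h3
  have h2' := lt_of_le_of_ne h2 (hx _).symm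
  rw [zpow_add₀ hg0.ne', zpow_one, mul_comm, zpow_neg, zpow_natCast, ← div_eq_mul_inv] at h3
  rw [zpow_neg, zpow_natCast] at h2'
  exact ⟨h1, h2', h3⟩

lemma qStar_spec {x : ℝ} (hx0 : 0 < x) (hx1 : x < 1)
    (hx : ∀ m : ℕ, x ≠ Real.goldenRatio ^ (-(m : ℤ))) :
    Real.goldenRatio < qStar x ∧ qStar x < 2 ∧ qStar x ^ level x * (qStar x - 1) = 1 / x := by
  obtain ⟨h1, h2, h3⟩ := level_spec hx0 hx1 hx
  have hg := Real.one_lt_goldenRatio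
  have hg2 := Real.goldenRatio_lt_two
  have hg0 : 0 < Real.goldenRatio := by linarith
  set m := level x with hm
  have hinv : 1 / x < Real.goldenRatio ^ m := by
    rw [one_div]
    exact inv_lt_of_inv_lt₀ (by positivity) h2
  have hex : ∃ q : ℝ, q ∈ Ioo (1 : ℝ) 2 ∧ q ^ m * (q - 1) = 1 / x := by
    have hc : ContinuousOn (fun q : ℝ => q ^ m * (q - 1)) (Icc 1 2) := by fun_prop
    refine intermediate_value_Ioo (by norm_num) hc ⟨?_, ?_⟩
    · simpa using hx0
    · have : Real.goldenRatio ^ m ≤ 2 ^ m := by gcongr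
      change 1 / x < 2 ^ m * (2 - 1)
      linarith
  obtain ⟨⟨h4, h5⟩, h6⟩ := Classical.epsilon_spec hex
  change 1 < qStar x at h4
  change qStar x < 2 at h5
  change qStar x ^ m * (qStar x - 1) = 1 / x at h6
  refine ⟨?_, h5, h6⟩
  by_contra hle
  have hle := not_lt.1 hle
  have h7 : qStar x ^ m * (qStar x - 1) ≤ Real.goldenRatio ^ m * (Real.goldenRatio - 1) := by
    have : 0 ≤ qStar x - 1 := by linarith
    have : 0 ≤ qStar x := by linarith
    gcongr
  rw [lt_div_iff₀ (by positivity)] at h3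
  rw [h6, div_le_iff₀ hx0] at h7
  have := Real.goldenRatio_sq
  nlinarith

lemma pre_replicate (q : ℝ) (n : ℕ) :
    pre q (prepend (List.replicate n false) zeros) (List.replicate n false).length = 0 := by
  refine Finset.sum_eq_zero fun i hi => ?_
  have : i < n := by simpa using hi
  simp [prepend, this]

lemma upperVal_zero {x : ℝ} (hm : 1 ≤ level x) {q : ℝ} (hq : 1 < q) :
    upperVal x 0 q = 1 / (q ^ level x * (q - 1)) := by
  rw [upperVal, word_zero, val_prepend_cons hq, val_ones hq, pre_replicate, List.length_replicate,
    Nat.sub_add_cancel hm]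
  simp only [Bool.false_eq_true, if_false, zero_add]
  rw [div_div, mul_comm]

lemma lowerVal_zero {x : ℝ} (hm : 1 ≤ level x) {q : ℝ} (hq : 1 < q) :
    lowerVal x 0 q = (q ^ level x)⁻¹ := by
  rw [lowerVal, word_zero, val_prepend_cons hq, val_zeros, pre_replicate, List.length_replicate,
    Nat.sub_add_cancel hm]
  simp

lemma Reached.mono {x : ℝ} {j k : ℕ} (h : Reached x k) (hjk : j ≤ k) : Reached x j :=
  fun i hi => h i (hi.trans_le hjk)

/-- The new upper value exceeds x at the old bound. In base 2 the ends of the new interval coincide,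
and the lower one has already dropped below x. The root lies between. -/
lemma lowerBound_succ_spec {x : ℝ} {k : ℕ} (hg : Real.goldenRatio < lowerBound x k)
    (h2 : lowerBound x k < 2) (hv : upperVal x k (lowerBound x k) = x)
    (hU : lowerBound x k ∉ closure U) : lowerBound x k < lowerBound x (k + 1) ∧
      lowerBound x (k + 1) < 2 ∧ upperVal x (k + 1) (lowerBound x (k + 1)) = x := by
  have h1 := Real.one_lt_goldenRatio.trans hg
  have e1 := lt_upperVal_succ hg h2 hU
  have e2 := lowerVal_succ_le hg h2 hU h1 le_rfl
  rw [hv] at e1 e2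
  have e3 : upperVal x (k + 1) 2 < x := by
    rw [upperVal_two]
    exact (lowerVal_strictAnti h1 h2).trans_le e2
  have hex : ∃ q : ℝ, q ∈ Ioc (1 : ℝ) 2 ∧
      IsExpansion q x (prepend (word x (k + 1)) (cons false ones)) := by
    obtain ⟨q, hq, hqx⟩ := exists_base h1 h2.le e1 e3
    exact ⟨q, ⟨h1.trans hq.1, hq.2.le⟩, (isExpansion_iff (h1.trans hq.1)).2 hqx⟩
  obtain ⟨⟨h3, h4⟩, h5⟩ := Classical.epsilon_spec hex
  rw [lowerBound_succ]
  change 1 < baseOf x _ at h3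
  change IsExpansion (baseOf x _) x _ at h5
  rw [isExpansion_iff h3] at h5
  exact ⟨lt_of_val_lt (h5.trans_lt e1) h3, lt_of_val_lt (e3.trans_eq h5.symm) (by norm_num), h5⟩

section Algorithm

variable {x : ℝ} (hx0 : 0 < x) (hx1 : x < 1)
  (hx : ∀ m : ℕ, x ≠ Real.goldenRatio ^ (-(m : ℤ)))

include hx0 hx1 hx

lemma lowerBound_spec {k : ℕ} (hR : Reached x k) : Real.goldenRatio < lowerBound x k ∧
    lowerBound x k < 2 ∧ upperVal x k (lowerBound x k) = x := by
  induction k with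
  | zero =>
    obtain ⟨h1, h2, h3⟩ := qStar_spec hx0 hx1 hx
    refine ⟨h1, h2, ?_⟩
    rw [lowerBound_zero, upperVal_zero (level_spec hx0 hx1 hx).1
      (Real.one_lt_goldenRatio.trans h1), h3, one_div_one_div]
  | succ k ih =>
    obtain ⟨h1, h2, h3⟩ := ih (hR.mono (by omega))
    obtain ⟨h4, h5, h6⟩ := lowerBound_succ_spec h1 h2 h3 (hR k (by omega))
    exact ⟨h1.trans h4, h5, h6⟩

lemma lowerBound_lt {j k : ℕ} (hR : Reached x k) (hjk : j < k) :
    lowerBound x j < lowerBound x k := by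
  induction k with
  | zero => omega
  | succ k ih =>
    have hR' := hR.mono (Nat.le_succ k)
    obtain ⟨h1, h2, h3⟩ := lowerBound_spec hx0 hx1 hx hR'
    have h4 := (lowerBound_succ_spec h1 h2 h3 (hR k (by omega))).1
    rcases Nat.lt_succ_iff_lt_or_eq.1 hjk with h | rfl
    · exact (ih hR' h).trans h4
    · exact h4

/-- If y is below the interval of step k + 1, then `hy` forces q ≤ `lowerBound x k`, and the overlap
puts y below the upper end at step k. The descent ends in bases at most the golden ratio. -/
lemma not_mem_univoqueBases_of_le_upperVal {k : ℕ} (hR : Reached x k) {y : ℝ} (hy0 : 0 < y)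
    (hy1 : y < 1) (hyg : (Real.goldenRatio ^ level x)⁻¹ ≤ y)
    (hy : ∀ i < k, lowerVal x (i + 1) (lowerBound x i) ≤ y) {q : ℝ} (hq : 1 < q)
    (hyq : y ≤ upperVal x k q) : q ∉ univoqueBases y := by
  have bracket : ∀ k, lowerVal x k q ≤ y → y ≤ upperVal x k q → q ∉ univoqueBases y := by
    intro k h1 h2
    rw [lowerVal, prepend_eq_glue] at h1
    rw [upperVal, prepend_eq_glue] at h2
    exact not_mem_univoqueBases_of_val _ _ h1 h2
  induction k with
  | zero =>
    by_cases h : lowerVal x 0 q ≤ y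
    · exact bracket 0 h hyq
    · refine not_mem_univoqueBases_of_le_goldenRatio ?_ hy0 hy1
      rw [lowerVal_zero (level_spec hx0 hx1 hx).1 hq, not_le] at h
      by_contra hlt
      have hg := Real.one_lt_goldenRatio
      have : (q ^ level x)⁻¹ ≤ (Real.goldenRatio ^ level x)⁻¹ := by
        have := (not_le.1 hlt).le
        gcongr
      linarith
  | succ k ih =>
    have hR' := hR.mono (Nat.le_succ k)
    obtain ⟨h1, h2, h3⟩ := lowerBound_spec hx0 hx1 hx hR'
    by_cases h : lowerVal x (k + 1) q ≤ y
    · exact bracket _ h hyq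
    · have h4 := not_le.1 h
      rcases le_or_gt q (lowerBound x k) with hqk | hqk
      · exact ih hR' (fun i hi => hy i (by omega))
          (h4.le.trans (lowerVal_succ_le h1 h2 (hR k (by omega)) hq hqk))
      · have h5 := lowerVal_strictAnti (x := x) (k := k + 1)
          (Real.one_lt_goldenRatio.trans h1) hqk
        linarith [hy k (by omega)]

/-- The expansion at j is the smaller one, so after M common digits its tail is smaller still, while
its reflection is larger; hence the defining inequality of its block index already holds at M + 1.
-/
lemma blockIndex_le_of_agree {j k M : ℕ} (hR : Reached x k) (hjk : j < k)
    (hM : toLex (shift M (alpha (lowerBound x k))) ≤ toLex (reflect (alpha (lowerBound x k))))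
    (h : ∀ i < M, alpha (lowerBound x j) i = alpha (lowerBound x k) i) :
    blockIndex (lowerBound x j) - 1 ≤ M := by
  obtain ⟨h1, _, _⟩ := lowerBound_spec hx0 hx1 hx (hR.mono hjk.le)
  obtain ⟨_, h2, _⟩ := lowerBound_spec hx0 hx1 hx hR
  have hlt := alpha_lt_alpha (Real.one_lt_goldenRatio.trans h1)
    (lowerBound_lt hx0 hx1 hx hR hjk) h2.le
  have h3 := ((shift_lt_shift hlt h).trans_le hM).trans (reflect_lt_reflect hlt)
  have h4 := reflect_lt_reflect h3
  rw [reflect_reflect] at h4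
  have : blockIndex (lowerBound x j) ≤ M + 1 := Nat.sInf_le ⟨by omega, by simpa using h4.le⟩
  omega

/-! ### Univoque continuations of the words -/

lemma lexUnivoque_prepend_word {k : ℕ} (hR : Reached x k) {c E : Digits} (hc0 : c 0 = true)
    (hc1 : c 1 = true) (hca : ∀ j < k, toLex (alpha (lowerBound x j)) < toLex c)
    (hE : ∀ i, toLex (reflect c) < toLex (shift i E) ∧ toLex (shift i E) < toLex c)
    (hE0 : E 0 = false)
    (hEj : ∀ j < k, LeUpTo (blockIndex (lowerBound x j) - 2) E
      (reflect (alpha (lowerBound x j)))) :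
    LexUnivoque c (prepend (word x k) (cons true E)) := by
  induction k generalizing E with
  | zero =>
    rw [word_zero]
    set n := level x - 1
    set d := prepend (List.replicate n false) (cons true E) with hd
    have d1 : ∀ i < n, d i = false := fun i hi => by simp [hd, prepend, hi]
    have d2 : d n = true := by simp [hd, prepend, cons]
    have d3 : ∀ i, shift (n + 1 + i) d = shift i E := by
      intro i
      funext j
      have : n + 1 + i + j - n = i + j + 1 := by omega
      simp [hd, shift, prepend, this, cons]
      omega
    intro i
    rcases lt_trichotomy i n with hi | rfl | hi
    · refine ⟨fun _ => ?_, fun h => absurd h (by simp [d1 i hi])⟩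
      rcases lt_or_ge (i + 1) n with hi' | hi'
      · exact FirstLt.lt (n := 0) ⟨by simp, d1 _ hi', hc0⟩
      · have hn : i + 1 = n := by omega
        rw [hn]
        -- The tail starts with 10 and c with 11.
        refine FirstLt.lt (n := 1) ⟨fun j hj => ?_, ?_, hc1⟩
        · obtain rfl : j = 0 := by omega
          rw [hc0]
          exact d2
        · have := congrFun (d3 0) 0
          simpa [shift, hE0] using this
    · have := hE 0
      rw [← d3 0] at this
      exact ⟨fun _ => this.2, fun _ => this.1⟩
    · obtain ⟨j, rfl⟩ := Nat.exists_eq_add_of_le hi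
      have := hE (j + 1)
      rw [← d3 (j + 1)] at this
      exact ⟨fun _ => this.2, fun _ => this.1⟩
  | succ k ih =>
    have hR' := hR.mono (Nat.le_succ k)
    obtain ⟨h1, h2, h3⟩ := lowerBound_spec hx0 hx1 hx hR'
    have hq1 := Real.one_lt_goldenRatio.trans h1
    obtain ⟨M, hb, hM2, hsp, hM⟩ := exists_block h1 h2 (hR k (by omega))
    have ha := isQG_alpha hq1 h2.le
    -- The 1 in front of E is the raised last digit of the reflected word, so the last block can be
    -- absorbed into E.
    have hword : prepend (word x (k + 1)) (cons true E) =
        prepend (word x k) (cons true (bump (alpha (lowerBound x k)) M E)) := by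
      rw [word_succ, prepend_append, prepend_block (M := M - 1) (by omega)]
      rfl
    rw [hword]
    have hak := hca k (by omega)
    have hF : LeUpTo (M - 1) E (reflect (alpha (lowerBound x k))) :=
      (hEj k (by omega)).mono (by omega)
    refine ih hR' (fun j hj => hca j (by omega)) (fun i => ?_) ?_ fun j hj => ?_
    · rcases lt_or_ge i M with hi | hi
      · exact ⟨(reflect_lt_reflect hak).trans
          (reflect_lt_shift_bump (ha.shift_le hq1) (hsp.last (by omega)) hi),
          (shift_bump_lt hsp hM2 hF hi).trans hak⟩
      · obtain ⟨l, rfl⟩ := Nat.exists_eq_add_of_le hi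
        rw [← shift_shift, shift_bump (by omega)]
        exact hE l
    · simp [bump_of_lt (show 0 + 1 < M by omega), ha.zero hq1]
    · obtain ⟨h1', h2', _⟩ := lowerBound_spec hx0 hx1 hx (hR'.mono hj.le)
      have hq1' := Real.one_lt_goldenRatio.trans h1'
      exact leUpTo_bump (K := blockIndex (lowerBound x j) - 1)
        ((isQG_alpha hq1' h2'.le).shift_le hq1')
        (alpha_lt_alpha hq1' (lowerBound_lt hx0 hx1 hx hR' hj) h2.le) (by omega)
        (blockIndex_le_of_agree hx0 hx1 hx hR' hj hM)
        (hEj j (by omega)) (by omega) (by omega)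

lemma lexUnivoque_cyc {k M : ℕ} (hR : Reached x k)
    (hsp : Special (alpha (lowerBound x k)) M) (hM : 2 ≤ M)
    (hK : ∀ j < k, (∀ i < M, alpha (lowerBound x j) i = alpha (lowerBound x k) i) →
      blockIndex (lowerBound x j) - 1 ≤ M) {p : ℝ} (hp : lowerBound x k < p) (hp2 : p ≤ 2) :
    LexUnivoque (alpha p) (prepend (word x k) (cons true (cyc (alpha (lowerBound x k)) M))) := by
  obtain ⟨h1, h2, h3⟩ := lowerBound_spec hx0 hx1 hx hR
  have hq1 := Real.one_lt_goldenRatio.trans h1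
  have ha := isQG_alpha hq1 h2.le
  have hp1 := hq1.trans hp
  have hc := isQG_alpha hp1 hp2
  have hac := alpha_lt_alpha hq1 hp hp2
  have hlt : ∀ j < k, toLex (alpha (lowerBound x j)) < toLex (alpha (lowerBound x k)) := by
    intro j hj
    obtain ⟨h1', _, _⟩ := lowerBound_spec hx0 hx1 hx (hR.mono hj.le)
    exact alpha_lt_alpha (Real.one_lt_goldenRatio.trans h1')
      (lowerBound_lt hx0 hx1 hx hR hj) h2.le
  refine lexUnivoque_prepend_word hx0 hx1 hx hR (hc.zero hp1) (hc.one (h1.trans hp))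
    (fun j hj => (hlt j hj).trans hac) (fun i => ?_) ?_ fun j hj => ?_
  · obtain ⟨e1, e2⟩ := shift_cyc_mem (ha.shift_le hq1) hsp hM i
    exact ⟨(reflect_lt_reflect hac).trans e1, e2.trans hac⟩
  · simp [cyc_eq_of_lt (show 0 + 1 < M by omega), ha.zero hq1]
  · obtain ⟨h1', h2', _⟩ := lowerBound_spec hx0 hx1 hx (hR.mono hj.le)
    have hq1' := Real.one_lt_goldenRatio.trans h1'
    exact (leUpTo_cyc ((isQG_alpha hq1' h2'.le).shift_le hq1') (hlt j hj) (by omega)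
      (hK j hj)).mono (by omega)

lemma lexUnivoque_reflect {k : ℕ} (hR : Reached x k) (hV : lowerBound x k ∈ V) {p : ℝ}
    (hp : lowerBound x k < p) (hp2 : p ≤ 2) : LexUnivoque (alpha p)
      (prepend (word x k) (cons true (reflect (alpha (lowerBound x k))))) := by
  obtain ⟨h1, h2, h3⟩ := lowerBound_spec hx0 hx1 hx hR
  have hq1 := Real.one_lt_goldenRatio.trans h1
  have ha := isQG_alpha hq1 h2.le
  have hp1 := hq1.trans hp
  have hc := isQG_alpha hp1 hp2
  have hac := alpha_lt_alpha hq1 hp hp2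
  have hlt : ∀ j < k, toLex (alpha (lowerBound x j)) < toLex (alpha (lowerBound x k)) := by
    intro j hj
    obtain ⟨h1', _, _⟩ := lowerBound_spec hx0 hx1 hx (hR.mono hj.le)
    exact alpha_lt_alpha (Real.one_lt_goldenRatio.trans h1')
      (lowerBound_lt hx0 hx1 hx hR hj) h2.le
  refine lexUnivoque_prepend_word hx0 hx1 hx hR (hc.zero hp1) (hc.one (h1.trans hp))
    (fun j hj => (hlt j hj).trans hac) (fun i => ?_) ?_ fun j hj => ?_
  · obtain ⟨e1, e2⟩ := hV.2 i
    rw [← reflect_shift]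
    refine ⟨(reflect_lt_reflect hac).trans_le (reflect_le_reflect e2), ?_⟩
    have := reflect_le_reflect e1
    rw [reflect_reflect] at this
    exact this.trans_lt hac
  · simp [reflect, ha.zero hq1]
  · exact leUpTo_of_le (reflect_lt_reflect (hlt j hj)).le _

end Algorithm

/-! ### Estimates for the periodic continuations -/

lemma bddBelow_univoqueBases (y : ℝ) : BddBelow (univoqueBases y) :=
  ⟨1, fun _ hp => hp.1.1.le⟩

lemma IsQG.val_reflect_lt_val_cyc {q : ℝ} (hq : 1 < q) {a : Digits} (ha : IsQG q a) {M : ℕ}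
    (hM : 2 ≤ M) (hsp : Special a M) : val q (reflect a) < val q (cyc a M) := by
  -- The digit 0 in front makes `val_shift_lt_one` apply to the whole reflected sequence.
  have h : ∀ i, (cons false (reflect (cyc a M))) i = false →
      toLex (shift (i + 1) (cons false (reflect (cyc a M)))) < toLex a := by
    intro i _
    have e : shift (i + 1) (cons false (reflect (cyc a M))) = reflect (shift i (cyc a M)) := by
      funext j
      simp [shift, reflect, (by ring : i + 1 + j = i + j + 1), cons]
    rw [e]
    have := reflect_lt_reflect (shift_cyc_mem (ha.shift_le hq) hsp hM i).1
    rwa [reflect_reflect] at this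
  have h1 := val_shift_lt_one hq ha.val_eq.le ha.inf h (i := 0) rfl
  have e : shift (0 + 1) (cons false (reflect (cyc a M))) = reflect (cyc a M) := by
    funext j
    simp [shift, add_comm 1 j, cons]
  rw [e, val_reflect hq] at h1
  rw [val_reflect hq, ha.val_eq]
  linarith

/-- One period, followed by zeros, is worth at most 1 / (q - 1) - 1 ≤ 2(2 - q); in base 2 the later
periods at most double this. -/
lemma val_two_cyc_le {q : ℝ} (hq : 3 / 2 < q) (hq2 : q < 2) {a : Digits} (ha : IsQG q a) {M : ℕ}
    (hM : 2 ≤ M) (hsp : Special a M) (h : toLex (shift M a) ≤ toLex (reflect a)) :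
    val 2 (cyc a M) ≤ 4 * (2 - q) := by
  have hq1 : 1 < q := by linarith
  obtain ⟨M, rfl⟩ := Nat.exists_eq_add_of_le' (show 1 ≤ M by omega)
  have h1 := ha.one_le_val_glue hq1 (M := M) (hsp.last (by omega)) h
  have h2 := val_reflect hq1 (glue a M (cons false ones))
  rw [reflect_glue, reflect_cons, reflect_ones] at h2
  have h3 := val_anti hq1 hq2.le (glue (reflect a) M (cons (!false) zeros))
  have h4 : val 2 (cyc a (M + 1)) =
      pre 2 (reflect a) M + (1 + val 2 (cyc a (M + 1))) / 2 ^ (M + 1) := by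
    nth_rw 1 [← bump_cyc a (show 0 < M + 1 by omega)]
    rw [bump, val_glue_cons (by norm_num)]
    rfl
  rw [val_glue_cons (q := 2) (by norm_num), val_zeros] at h3
  simp only [Bool.not_false, if_true, add_zero] at h3
  have h5 := val_nonneg (q := 2) (by norm_num) (cyc a (M + 1))
  have h6 : val 2 (cyc a (M + 1)) / 2 ^ (M + 1) ≤ val 2 (cyc a (M + 1)) / 2 := by
    gcongr
    exact le_self_pow₀ (by norm_num) (by omega)
  rw [add_div] at h4
  have h7 : 1 / (q - 1) - 1 ≤ 2 * (2 - q) := by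
    have : 0 < q - 1 := by linarith
    rw [sub_le_iff_le_add, div_le_iff₀ this]
    nlinarith
  simp only [Bool.not_false] at h2
  linarith

/-! ### Limits of q_s at x -/

section Limits

variable {x : ℝ} (hx0 : 0 < x) (hx1 : x < 1)
  (hx : ∀ m : ℕ, x ≠ Real.goldenRatio ^ (-(m : ℤ)))

include hx0 hx1 hx

lemma eventually_lt_of_mem_univoqueBases {k : ℕ} (hR : Reached x k) {b : ℝ}
    (hb : b < lowerBound x k) :
    ∀ᶠ y in 𝓝 x, (∀ i < k, lowerVal x (i + 1) (lowerBound x i) ≤ y) →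
      ∀ q ∈ univoqueBases y, b < q := by
  obtain ⟨h1, h2, h3⟩ := lowerBound_spec hx0 hx1 hx hR
  have hq1 := Real.one_lt_goldenRatio.trans h1
  obtain ⟨r, hr1, hr2, hr3⟩ : ∃ r, 1 < r ∧ r < lowerBound x k ∧ b ≤ r :=
    ⟨max ((1 + lowerBound x k) / 2) b, lt_max_of_lt_left (by linarith),
      max_lt (by linarith) hb, le_max_right _ _⟩
  have h4 : x < upperVal x k r := h3.symm.trans_lt (upperVal_strictAnti hr1 hr2)
  filter_upwards [eventually_lt_nhds h4, eventually_gt_nhds hx0, eventually_lt_nhds hx1,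
    eventually_gt_nhds (level_spec hx0 hx1 hx).2.1] with y e1 e2 e3 e4 hy q hq
  by_contra hle
  exact not_mem_univoqueBases_of_le_upperVal hx0 hx1 hx hR e2 e3 e4.le hy hq.1.1
    (e1.le.trans (val_anti hq.1.1 ((not_lt.1 hle).trans hr3) _)) hq

lemma lowerVal_succ_le_self {k : ℕ} (hR : Reached x (k + 1)) :
    lowerVal x (k + 1) (lowerBound x k) ≤ x := by
  obtain ⟨h1, h2, h3⟩ := lowerBound_spec hx0 hx1 hx (hR.mono (Nat.le_succ k))
  exact (lowerVal_succ_le h1 h2 (hR k (by omega)) (Real.one_lt_goldenRatio.trans h1)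
    le_rfl).trans_eq h3

lemma lowerVal_succ_lt_self {k : ℕ} (hR : Reached x (k + 1)) (hk : k ∉ jumpSteps x) :
    lowerVal x (k + 1) (lowerBound x k) < x := by
  have hR' := hR.mono (Nat.le_succ k)
  have hU := hR k (by omega)
  obtain ⟨h1, h2, h3⟩ := lowerBound_spec hx0 hx1 hx hR'
  exact (lowerVal_succ_lt h1 h2 hU fun hV => hk ⟨hR', hV, hU⟩).trans_eq h3

lemma eventually_lowerVal_le {k : ℕ} (hR : Reached x k) (hk : ∀ i < k, i ∉ jumpSteps x) :
    ∀ᶠ y in 𝓝 x, ∀ i < k, lowerVal x (i + 1) (lowerBound x i) ≤ y :=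
  (eventually_all_finite (Set.finite_Iio k)).2 fun i hi =>
    (eventually_gt_nhds (lowerVal_succ_lt_self hx0 hx1 hx
      (hR.mono (Nat.succ_le_of_lt hi)) (hk i hi))).mono fun _ h => h.le

lemma lowerBound_le_of_mem {k : ℕ} (hR : Reached x k) {p : ℝ} (hp : p ∈ univoqueBases x) :
    lowerBound x k ≤ p := by
  refine le_of_forall_lt fun b hb => ?_
  exact (eventually_lt_of_mem_univoqueBases hx0 hx1 hx hR hb).self_of_nhds
    (fun i hi => lowerVal_succ_le_self hx0 hx1 hx (hR.mono (Nat.succ_le_of_lt hi))) p hp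

lemma val_prepend_word_reflect {k : ℕ} (hR : Reached x k) : val (lowerBound x k)
    (prepend (word x k) (cons true (reflect (alpha (lowerBound x k))))) = x := by
  obtain ⟨h1, h2, h3⟩ := lowerBound_spec hx0 hx1 hx hR
  rw [val_prepend_reflect_alpha (Real.one_lt_goldenRatio.trans h1) h2.le]
  exact h3

lemma lt_val_prepend_word_cyc {k M : ℕ} (hR : Reached x k) (hM : 2 ≤ M)
    (hsp : Special (alpha (lowerBound x k)) M) : x < val (lowerBound x k)
      (prepend (word x k) (cons true (cyc (alpha (lowerBound x k)) M))) := by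
  obtain ⟨h1, h2, h3⟩ := lowerBound_spec hx0 hx1 hx hR
  have hq1 := Real.one_lt_goldenRatio.trans h1
  have h4 := (isQG_alpha hq1 h2.le).val_reflect_lt_val_cyc hq1 hM hsp
  have h5 := val_prepend_word_reflect hx0 hx1 hx hR
  rw [val_prepend_cons hq1] at h5 ⊢
  refine h5.symm.trans_lt ?_
  gcongr

lemma eventually_exists_of_mem_closure {k : ℕ} (hR : Reached x k)
    (hU : lowerBound x k ∈ closure U) {R : ℝ} (hkR : lowerBound x k < R) :
    ∀ᶠ y in 𝓝 x, ∃ p ∈ univoqueBases y, p < R := by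
  obtain ⟨h1, h2, h3⟩ := lowerBound_spec hx0 hx1 hx hR
  have hq1 := Real.one_lt_goldenRatio.trans h1
  have ha := isQG_alpha hq1 h2.le
  have hS : ∀ n, toLex (reflect (alpha (lowerBound x k))) <
      toLex (shift n (alpha (lowerBound x k))) := by
    intro n
    by_contra hle
    exact not_mem_closure_U h1 h2 ⟨n, not_lt.1 hle⟩ hU
  obtain ⟨N, ε, hε, hN⟩ := exists_base_near (prepend_cons_length _ _ _) hq1
    (val_prepend_word_reflect hx0 hx1 hx hR) (lt_min (sub_pos.2 hkR) (sub_pos.2 h2))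
  -- Taking M beyond all earlier block indices makes the agreement condition of `lexUnivoque_cyc`
  -- automatic.
  set K := (Finset.range k).sup fun j => blockIndex (lowerBound x j) with hK
  obtain ⟨M, hM, hsp⟩ := exists_special (ha.shift_le hq1) hS (N + 2 + K)
  have hlt := lt_val_prepend_word_cyc hx0 hx1 hx hR (by omega) hsp
  filter_upwards [eventually_lt_nhds hlt, Metric.ball_mem_nhds x hε] with y hy1 hy2
  have agree : ∀ i < N, prepend (word x k) (cons true (cyc (alpha (lowerBound x k)) M)) i =
      prepend (word x k) (cons true (reflect (alpha (lowerBound x k)))) i := by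
    intro i hi
    by_cases h : i < (word x k).length
    · simp [prepend, h]
    · simp only [prepend, h, dite_false]
      cases hj : i - (word x k).length with
      | zero => rfl
      | succ j => exact cyc_eq_of_lt (by omega)
  obtain ⟨p, hp1, hp2, hp3⟩ := hN _ agree y (by simpa [Real.dist_eq] using hy2)
  have hpk : lowerBound x k < p := lt_of_val_lt (hp3.trans_lt hy1) hp1
  have hp2' := (abs_lt.1 hp2).2
  have hpR : p < R := by linarith [min_le_left (R - lowerBound x k) (2 - lowerBound x k)]
  have hp2'' : p ≤ 2 := by linarith [min_le_right (R - lowerBound x k) (2 - lowerBound x k)]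
  have hc := isQG_alpha hp1 hp2''
  refine ⟨p, LexUnivoque.mem hp1 hp2'' hc.val_eq.le hc.inf
    (lexUnivoque_cyc hx0 hx1 hx hR hsp (by omega) (fun j hj _ => ?_) hpk hp2'') hp3, hpR⟩
  have : blockIndex (lowerBound x j) ≤ K :=
    Finset.le_sup (f := fun j => blockIndex (lowerBound x j)) (Finset.mem_range.2 hj)
  omega

lemma eventually_exists_of_mem_V {k : ℕ} (hR : Reached x k) (hV : lowerBound x k ∈ V) {R : ℝ}
    (hkR : lowerBound x k < R) : ∀ᶠ y in 𝓝[<] x, ∃ p ∈ univoqueBases y, p < R := by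
  obtain ⟨h1, h2, h3⟩ := lowerBound_spec hx0 hx1 hx hR
  have hq1 := Real.one_lt_goldenRatio.trans h1
  have hv := val_prepend_word_reflect hx0 hx1 hx hR
  obtain ⟨N, ε, hε, hN⟩ := exists_base_near (prepend_cons_length _ _ _) hq1
    hv (lt_min (sub_pos.2 hkR) (sub_pos.2 h2))
  filter_upwards [self_mem_nhdsWithin,
    mem_nhdsWithin_of_mem_nhds (Metric.ball_mem_nhds x hε)] with y hy1 hy2
  obtain ⟨p, hp1, hp2, hp3⟩ := hN _ (fun _ _ => rfl) y (by simpa [Real.dist_eq] using hy2)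
  have hpk : lowerBound x k < p :=
    lt_of_val_lt (hp3.trans_lt (lt_of_lt_of_eq hy1 hv.symm)) hp1
  have hp2' := (abs_lt.1 hp2).2
  have hpR : p < R := by linarith [min_le_left (R - lowerBound x k) (2 - lowerBound x k)]
  have hp2'' : p ≤ 2 := by linarith [min_le_right (R - lowerBound x k) (2 - lowerBound x k)]
  have hc := isQG_alpha hp1 hp2''
  exact ⟨p, LexUnivoque.mem hp1 hp2'' hc.val_eq.le hc.inf
    (lexUnivoque_reflect hx0 hx1 hx hR hV hpk hp2'') hp3, hpR⟩

/-- The periodic continuation absorbs the next block, so it can be read after the longer word. At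
the old bound its value exceeds x. At R, by `hpow`, it is below w10^∞ taken at the old bound, where
w is the longer word, and that is at most x. -/
lemma eventually_exists_of_pow {k M : ℕ} (hR : Reached x (k + 1))
    (hb : blockIndex (lowerBound x k) = M + 1) (hM2 : 2 ≤ M)
    (hsp : Special (alpha (lowerBound x k)) M)
    (hM : toLex (shift M (alpha (lowerBound x k))) ≤ toLex (reflect (alpha (lowerBound x k))))
    {R : ℝ} (hkR : lowerBound x k < R) (hR2 : R ≤ 2)
    (hpow : 1 + val R (cyc (alpha (lowerBound x k)) M) <
      (R / lowerBound x k) ^ ((word x (k + 1)).length + 1)) :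
    ∀ᶠ y in 𝓝 x, ∃ p ∈ univoqueBases y, p < R := by
  have hR' := hR.mono (Nat.le_succ k)
  obtain ⟨h1, h2, h3⟩ := lowerBound_spec hx0 hx1 hx hR'
  have hq1 := Real.one_lt_goldenRatio.trans h1
  have hR1 := hq1.trans hkR
  set e := cyc (alpha (lowerBound x k)) M with he
  have hword : prepend (word x (k + 1)) (cons true e) = prepend (word x k) (cons true e) := by
    rw [word_succ, prepend_append, prepend_block (M := M - 1) (by omega)]
    congr 2
    exact bump_cyc _ (by omega)
  have hlt := lt_val_prepend_word_cyc hx0 hx1 hx hR' hM2 hsp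
  rw [← he, ← hword] at hlt
  have hgt : val R (prepend (word x (k + 1)) (cons true e)) < x := by
    refine lt_of_lt_of_le ?_ (lowerVal_succ_le_self hx0 hx1 hx hR)
    rw [lowerVal, val_prepend_cons hR1, val_prepend_cons hq1, val_zeros]
    refine add_lt_add_of_le_of_lt (pre_anti (by linarith) hkR.le _ _) ?_
    simp only [if_true, add_zero]
    rw [div_pow, lt_div_iff₀ (by positivity)] at hpow
    rw [div_lt_div_iff₀ (by positivity) (by positivity)]
    linarith
  filter_upwards [eventually_lt_nhds hlt, eventually_gt_nhds hgt] with y hy1 hy2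
  obtain ⟨p, hp, hpy⟩ := exists_base hq1 hkR.le hy1 hy2
  have hp1 := hq1.trans hp.1
  have hp2 : p ≤ 2 := hp.2.le.trans hR2
  have hc := isQG_alpha hp1 hp2
  refine ⟨p, LexUnivoque.mem hp1 hp2 hc.val_eq.le hc.inf ?_ hpy, hp.2⟩
  rw [hword]
  exact lexUnivoque_cyc hx0 hx1 hx hR' hsp hM2
    (fun j hj => blockIndex_le_of_agree hx0 hx1 hx hR' hj hM) hp.1 hp2

omit hx0 hx1 hx in
lemma le_length_word (k : ℕ) : k ≤ (word x k).length := by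
  induction k with
  | zero => omega
  | succ k ih =>
    have : 1 ≤ (block (lowerBound x k)).length := by simp [block]
    rw [word_succ, List.length_append]
    omega

lemma exists_mem_univoqueBases_lt_two (hU : ∀ k, lowerBound x k ∉ closure U) :
    ∃ p ∈ univoqueBases x, p < 2 := by
  have hR : ∀ k, Reached x k := fun k j _ => hU j
  -- With exponent L ≥ 9, Bernoulli gives (2/q)^L ≥ 1 + (9/2)(2 - q), which beats 1 + 4(2 - q) from
  -- `val_two_cyc_le`.
  obtain ⟨h1, h2, h3⟩ := lowerBound_spec hx0 hx1 hx (hR 9)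
  have hq1 := Real.one_lt_goldenRatio.trans h1
  obtain ⟨M, hb, hM2, hsp, hM⟩ := exists_block h1 h2 (hU 9)
  have h32 : 3 / 2 < lowerBound x 9 := by
    refine lt_trans ?_ h1
    have := Real.goldenRatio_sq
    have := Real.one_lt_goldenRatio
    nlinarith
  refine (eventually_exists_of_pow hx0 hx1 hx (hR 10) hb hM2 hsp hM h2 le_rfl ?_).self_of_nhds
  have h4 := val_two_cyc_le h32 h2 (isQG_alpha hq1 h2.le) hM2 hsp hM
  set q := lowerBound x 9
  set L := (word x (9 + 1)).length + 1 with hL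
  have hL9 : (9 : ℝ) ≤ L := by
    have := le_length_word (x := x) (9 + 1)
    exact_mod_cast (by omega : 9 ≤ L)
  have h5 : (2 - q) / 2 ≤ 2 / q - 1 := by
    rw [div_sub_one (by linarith)]
    gcongr
  have h6 := one_add_mul_le_pow (a := 2 / q - 1) (by linarith) L
  rw [add_sub_cancel] at h6
  have h7 : 9 * ((2 - q) / 2) ≤ L * (2 / q - 1) :=
    mul_le_mul hL9 h5 (by linarith) (by linarith)
  linarith

lemma eventually_exists_of_forall {Q R : ℝ} (hU : ∀ k, lowerBound x k ∉ closure U)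
    (hQ : ∀ k, lowerBound x k ≤ Q) (hQ2 : Q < 2) (hQR : Q < R) :
    ∀ᶠ y in 𝓝 x, ∃ p ∈ univoqueBases y, p < R := by
  have hR : ∀ k, Reached x k := fun k j _ => hU j
  set S := min R 2 with hS
  have hQS : Q < S := lt_min hQR hQ2
  have hQ1 : 1 < Q := (Real.one_lt_goldenRatio.trans
    (lowerBound_spec hx0 hx1 hx (hR 0)).1).trans_le (hQ 0)
  -- The periodic continuation is worth at most 1 / (S - 1) in base S, whatever k is.
  obtain ⟨k, hk⟩ := pow_unbounded_of_one_lt (1 + 1 / (S - 1))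
    ((one_lt_div (by linarith)).2 hQS)
  obtain ⟨h1, h2, h3⟩ := lowerBound_spec hx0 hx1 hx (hR k)
  have hq1 := Real.one_lt_goldenRatio.trans h1
  obtain ⟨M, hb, hM2, hsp, hM⟩ := exists_block h1 h2 (hU k)
  refine (eventually_exists_of_pow hx0 hx1 hx (hR (k + 1)) hb hM2 hsp hM ((hQ k).trans_lt hQS)
    (min_le_right _ _) ?_).mono fun y ⟨p, hp, hpS⟩ => ⟨p, hp, hpS.trans_le (min_le_left _ _)⟩
  have h4 := val_le (hQ1.trans hQS) (cyc (alpha (lowerBound x k)) M)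
  have h5 : (S / Q) ^ k ≤ (S / lowerBound x k) ^ ((word x (k + 1)).length + 1) := by
    have hlen := le_length_word (x := x) (k + 1)
    calc (S / Q) ^ k ≤ (S / Q) ^ ((word x (k + 1)).length + 1) :=
          pow_le_pow_right₀ ((one_le_div (by linarith)).2 hQS.le) (by omega)
      _ ≤ _ := by
        have := hQ k
        have : 0 ≤ S := by linarith
        have : 0 < lowerBound x k := by linarith
        gcongr
  linarith

/-- The limit of the lower bounds, which is also the last one if the algorithm stops. -/
lemma exists_limit : ∃ Q : ℝ, (∀ k, Reached x k → lowerBound x k ≤ Q) ∧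
    (∀ b < Q, ∃ k, Reached x k ∧ b < lowerBound x k) ∧
    ∀ R, Q < R → ∀ᶠ y in 𝓝 x, ∃ p ∈ univoqueBases y, p < R := by
  classical
  by_cases h : ∃ k, lowerBound x k ∈ closure U
  · have hR : Reached x (Nat.find h) := fun j hj => Nat.find_min h hj
    refine ⟨lowerBound x (Nat.find h), fun k hk => ?_, fun b hb => ⟨_, hR, hb⟩, fun R hQR =>
      eventually_exists_of_mem_closure hx0 hx1 hx hR (Nat.find_spec h) hQR⟩
    rcases lt_trichotomy k (Nat.find h) with hlt | heq | hgt
    · exact (lowerBound_lt hx0 hx1 hx hR hlt).le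
    · rw [← heq]
    · exact absurd (Nat.find_spec h) (hk _ hgt)
  · push Not at h
    have hR : ∀ k, Reached x k := fun k j _ => h j
    obtain ⟨p, hp, hp2⟩ := exists_mem_univoqueBases_lt_two hx0 hx1 hx h
    have hbdd : ∀ k, lowerBound x k ≤ p := fun k => lowerBound_le_of_mem hx0 hx1 hx (hR k) hp
    have hbdd' : BddAbove (range (lowerBound x)) := ⟨p, by rintro _ ⟨k, rfl⟩; exact hbdd k⟩
    have hle : ∀ k, lowerBound x k ≤ ⨆ k, lowerBound x k := le_ciSup hbdd'
    refine ⟨⨆ k, lowerBound x k, fun k _ => hle k, fun b hb => ?_, fun R hQR =>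
      eventually_exists_of_forall hx0 hx1 hx h hle ((ciSup_le hbdd).trans_lt hp2) hQR⟩
    obtain ⟨k, hk⟩ := exists_lt_of_lt_ciSup hb
    exact ⟨k, hR k, hk⟩

lemma tendsto_qs {F : Filter ℝ} (hF : F ≤ 𝓝 x) {Q : ℝ}
    (hlow : ∀ b < Q, ∃ k, Reached x k ∧ b < lowerBound x k ∧
      ∀ᶠ y in F, ∀ i < k, lowerVal x (i + 1) (lowerBound x i) ≤ y)
    (hup : ∀ R, Q < R → ∀ᶠ y in F, ∃ p ∈ univoqueBases y, p < R) :
    Tendsto qs F (𝓝 Q) := by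
  refine tendsto_order.2 ⟨fun b hb => ?_, fun R hQR => ?_⟩
  · obtain ⟨c, hbc, hcQ⟩ := exists_between hb
    obtain ⟨k, hR, hk, hev⟩ := hlow c hcQ
    filter_upwards [hev, hF (eventually_lt_of_mem_univoqueBases hx0 hx1 hx hR hk),
      -- Only nonemptiness is taken from `hup` here: the infimum of the empty set would be 0.
      hup (Q + 1) (by linarith)] with y h1 h2 ⟨p, hp, _⟩
    exact hbc.trans_le (le_csInf ⟨p, hp⟩ fun q hq => (h2 h1 q hq).le)
  · filter_upwards [hup R hQR] with y ⟨p, hp, hpR⟩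
    exact (csInf_le (bddBelow_univoqueBases y) hp).trans_lt hpR

end Limits

end

end UnivoqueBase

theorem proposition4 (x : ℝ) (hx0 : 0 < x) (hx1 : x < 1)
    (hx : ∀ m : ℕ, x ≠ Real.goldenRatio ^ (-(m : ℤ))) :
    (UnivoqueBase.HasJumpAt UnivoqueBase.qs x ↔ ∃ k : ℕ, k ∈ UnivoqueBase.jumpSteps x) ∧
    ∀ k₀ : ℕ, IsLeast (UnivoqueBase.jumpSteps x) k₀ →
      Tendsto UnivoqueBase.qs (𝓝[<] x) (𝓝 (UnivoqueBase.lowerBound x k₀)) ∧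
      UnivoqueBase.lowerBound x k₀ < UnivoqueBase.qs x := by
  classical
  open UnivoqueBase in
  obtain ⟨Q, hQ1, hQ2, hQ3⟩ := exists_limit hx0 hx1 hx
  -- Including x itself in the filter yields q_s(x) = Q as well.
  have right : Tendsto qs (𝓝[≥] x) (𝓝 Q) := by
    refine tendsto_qs hx0 hx1 hx nhdsWithin_le_nhds (fun b hb => ?_)
      fun R hR => nhdsWithin_le_nhds (hQ3 R hR)
    obtain ⟨k, hR, hk⟩ := hQ2 b hb
    refine ⟨k, hR, hk, ?_⟩
    filter_upwards [self_mem_nhdsWithin] with y hy i hi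
    exact (lowerVal_succ_le_self hx0 hx1 hx (hR.mono (Nat.succ_le_of_lt hi))).trans hy
  have hqs : qs x = Q := by
    have h := right.mono_left (pure_le_nhdsWithin self_mem_Ici)
    exact tendsto_nhds_unique (tendsto_pure_nhds qs x) h
  have least : ∀ k₀, IsLeast (jumpSteps x) k₀ →
      Tendsto qs (𝓝[<] x) (𝓝 (lowerBound x k₀)) ∧ lowerBound x k₀ < qs x := by
    rintro k₀ ⟨⟨hR, hV, hU⟩, hmin⟩
    constructor
    · refine tendsto_qs hx0 hx1 hx nhdsWithin_le_nhds (fun b hb => ⟨k₀, hR, hb, ?_⟩)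
        fun R hkR => eventually_exists_of_mem_V hx0 hx1 hx hR hV hkR
      exact nhdsWithin_le_nhds (eventually_lowerVal_le hx0 hx1 hx hR
        fun i hi hmem => absurd (hmin hmem) (not_le.2 hi))
    · have hR' : Reached x (k₀ + 1) := fun j hj => by
        rcases Nat.lt_succ_iff_lt_or_eq.1 hj with h | rfl
        · exact hR j h
        · exact hU
      rw [hqs]
      exact (lowerBound_lt hx0 hx1 hx hR' (Nat.lt_succ_self _)).trans_le (hQ1 _ hR')
  refine ⟨⟨?_, ?_⟩, least⟩
  · rintro ⟨l, r, hl, hr, hne⟩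
    by_contra hno
    push Not at hno
    -- Without jump steps all overlaps are strict, so the lower estimates hold on both sides of x.
    have full : Tendsto qs (𝓝 x) (𝓝 Q) := by
      refine tendsto_qs hx0 hx1 hx le_rfl (fun b hb => ?_) hQ3
      obtain ⟨k, hR, hk⟩ := hQ2 b hb
      exact ⟨k, hR, hk, eventually_lowerVal_le hx0 hx1 hx hR fun i _ => hno i⟩
    exact hne ((tendsto_nhds_unique hl (full.mono_left nhdsWithin_le_nhds)).trans
      (tendsto_nhds_unique hr (full.mono_left nhdsWithin_le_nhds)).symm)
  · intro hex
    obtain ⟨h1, h2⟩ := least _ ⟨Nat.find_spec hex, fun k hk => Nat.find_min' hex hk⟩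
    refine ⟨_, Q, h1, right.mono_left (nhdsWithin_mono _ Ioi_subset_Ici_self), ?_⟩
    rw [hqs] at h2
    exact h2.ne
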